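/- For $m\ge 1$ and $\lambda_1,\dots,\lambda_m$ in the open unit disk $\mathbb D$, call $B(z)=\prod_{j=1}^m \frac{z-\lambda_j}{1-\overline{\lambda_j}z}$ the Blaschke product of degree $m$ with zeros $\lambda_1,\dots,\lambda_m$ (repeated according to multiplicity). For $n\ge 1$ and $k\ge 0$ put $\widehat{B^n}(k)=\frac1{2\pi}\int_0^{2\pi}B(e^{i\theta})^n e^{-ik\theta}\,d\theta$ and $\|\widehat{B^n}\|_{\ell^\infty}=\sup_{k\ge0}|\widehat{B^n}(k)|$. Write $\|\widehat{B^n}\|_{\ell^\infty}\asymp n^{-1/N}$ if there are constants $c,C>0$ (which may depend on $B$ and $N$) with $c\,n^{-1/N}\le\|\widehat{B^n}\|_{\ell^\infty}\le C\,n^{-1/N}$ for all $n\ge1$. Let $\psi_B:\mathbb R\to\mathbb R$ be a continuous argument of $B$ on the unit circle, i.e. $B(e^{i\theta})=e^{i\psi_B(\theta)}$; it is smooth and unique up to an additive constant in $2\pi\mathbb Z$. For every integer $N\ge3$ there is a Blaschke product $B$ of degree $N$ with zeros in $\mathbb D\setminus\{0\}$ such that $\|\widehat{B^n}\|_{\ell^\infty}\asymp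 n^{-1/N}$. More precisely, with $u=e^{2\pi i/N}$ there is $t\in(0,\frac1{2\pi})$ such that, with $\zeta=t\,e^{\pi i(N-1)/(2N)}$, the Blaschke product $B$ with zeros $\lambda_j=\overline{\zeta u^j}/(1+\overline{\zeta u^j})\in\mathbb D\setminus\{0\}$, $1\le j\le N$, satisfies this estimate, $\psi_B''$ vanishes at $0$ to order exactly $N-2$, and at every point of $\mathbb R$ the order of vanishing of $\psi_B''$ is at most $N-2$. Moreover: (1) Every Blaschke product $B(z)=\frac{z-\lambda}{1-\bar\lambda z}$ of degree $1$, $\lambda\in\mathbb D$, different from the identity satisfies $\|\widehat{B^n}\|_{\ell^\infty}\asymp n^{-1/3}$. (2) There are Blaschke products of degree $2$ with $\|\widehat{B^n}\|_{\ell^\infty}\asymp n^{-1/5}$. Namely, this holds for the zeros $\lambda_j=\frac{w_j-1}{w_j+1}\in\mathbb D\setminus\{0\}$, $j=1,2$, in each of the following cases: (a) $w_1=w$, $w_2=\overline w$, where $w\in\mathbb C\setminus\{1\}$, $\Re w>0$, $\Re w=\Re w^3\ne\Re w^5$ and $\Re w^{-1}\ne\Re w^{-3}$; in particular for $w=2+i$;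 (b) $w_1,w_2\in(0,\infty)\setminus\{1\}$, $w_1+w_2=w_1^3+w_2^3\ne w_1^5+w_2^5$ and $w_1^{-1}+w_2^{-1}\ne w_1^{-3}+w_2^{-3}$; in particular for $w_1=\frac12$, $w_2=\frac{1+\sqrt{13}}4$. (3) There is a Blaschke product of degree $4$ with $\|\widehat{B^n}\|_{\ell^\infty}\asymp n^{-1/7}$. Namely, this holds for the zeros $\lambda_j=\frac{w_j-1}{w_j+1}\in\mathbb D\setminus\{0\}$, $1\le j\le4$, with $w_3=\overline{w_1}$, $w_4=\overline{w_2}$, whenever $w_1,w_2\in\mathbb C\setminus\{1\}$, $\Re w_1,\Re w_2>0$, $\Re(w_1+w_2)=\Re(w_1^3+w_2^3)=\Re(w_1^5+w_2^5)\ne\Re(w_1^7+w_2^7)$ and $\Re(w_1^{-1}+w_2^{-1})\ne\Re(w_1^{-3}+w_2^{-3})$; in particular for $w_1=1+\frac{2i}{\sqrt3}$, $w_2=2+\frac{i}{\sqrt3}$. -/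

import Mathlib

open scoped ComplexConjugate ContDiff

noncomputable section

/-- The finite Blaschke product `∏ j, (z - σ j) / (1 - conj (σ j) * z)` of degree `m` with zeros
`σ 0, …, σ (m - 1)`, repeated according to multiplicity. -/
def blaschke {m : ℕ} (σ : Fin m → ℂ) (z : ℂ) : ℂ :=
  ∏ j, (z - σ j) / (1 - conj (σ j) * z)

/-- All zeros lie in the open unit disk and none of them is the origin. -/
def IsZeroTuple {m : ℕ} (σ : Fin m → ℂ) : Prop :=
  ∀ j, ‖σ j‖ < 1 ∧ σ j ≠ 0

/-- The `k`-th Fourier coefficient of the restriction of `f` to the unit circle. -/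
def circleCoeff (f : ℂ → ℂ) (k : ℕ) : ℂ :=
  (1 / (2 * Real.pi) : ℂ) *
    ∫ θ in (0 : ℝ)..(2 * Real.pi),
      f (Complex.exp (Complex.I * θ)) * Complex.exp (-(Complex.I * k * θ))

/-- The supremum over `k ≥ 0` of the moduli of the Fourier coefficients of `f`. The family is
bounded whenever `f` is bounded on the unit circle. -/
def coeffSup (f : ℂ → ℂ) : ℝ :=
  ⨆ k : ℕ, ‖circleCoeff f k‖

/-- Comparability of two functions of the integer `n ≥ 1`. -/
def Comparable (f g : ℕ → ℝ) : Prop :=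
  (∃ c : ℝ, 0 < c ∧ ∀ n : ℕ, 1 ≤ n → f n ≤ c * g n) ∧
    (∃ c : ℝ, 0 < c ∧ ∀ n : ℕ, 1 ≤ n → g n ≤ c * f n)

/-- The estimate `‖B^n‖ ≍ n^(-1/N)` for the supremum norm of the Fourier coefficients of the
powers of `B`. -/
def PowersDecay (B : ℂ → ℂ) (N : ℕ) : Prop :=
  Comparable (fun n => coeffSup (fun z => B z ^ n)) (fun n => (n : ℝ) ^ (-(1 / (N : ℝ))))

/-- `ψ` is a continuous argument of `B` along the unit circle. Such a `ψ` is unique up to an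
additive constant in `2πℤ`. -/
def IsContinuousArg (B : ℂ → ℂ) (ψ : ℝ → ℝ) : Prop :=
  Continuous ψ ∧ ∀ θ : ℝ, B (Complex.exp (Complex.I * θ)) = Complex.exp (Complex.I * ψ θ)

/-- The (smooth) function `f` vanishes at `x` to order exactly `k`
(`k = 0` means that `f x ≠ 0`). -/
def VanishesToOrder (f : ℝ → ℝ) (x : ℝ) (k : ℕ) : Prop :=
  (∀ i < k, iteratedDeriv i f x = 0) ∧ iteratedDeriv k f x ≠ 0

/-- With `u = exp (2πi/N)` and `ζ = t * exp (πi(N-1)/(2N))`, the points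
`conj (ζ u^j) / (1 + conj (ζ u^j))`, `1 ≤ j ≤ N`. -/
def rootZeros (N : ℕ) (t : ℝ) : Fin N → ℂ := fun j =>
  let u : ℂ := Complex.exp (2 * Real.pi * Complex.I / N)
  let ζ : ℂ := t * Complex.exp (Real.pi * Complex.I * ((N : ℂ) - 1) / (2 * N))
  conj (ζ * u ^ ((j : ℕ) + 1)) / (1 + conj (ζ * u ^ ((j : ℕ) + 1)))

/-- The zeros `(w j - 1) / (w j + 1)`. -/
def cayleyZeros {m : ℕ} (w : Fin m → ℂ) : Fin m → ℂ := fun j =>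
  (w j - 1) / (w j + 1)

end

open scoped ComplexConjugate ContDiff
open Set Filter Topology MeasureTheory

/-! Write `B(e^{iθ}) = e^{iψ(θ)}`. The `k`-th coefficient of `B^n` is then an oscillatory integral
with phase `nψ(θ) - kθ`, and everything reduces to one principle (`powersDecay_of_arg`): if `N - 2`
is the largest order of vanishing of `ψ''`, the supremum is comparable to `n^(-1/N)`.

Upper bound: at each point some derivative of `ψ` of order between `2` and `N` is nonzero. The
linear term `kθ` does not affect it, so van der Corput's lemma and compactness give `O(n^(-1/N))`
uniformly in `k` (`exists_norm_integral_osc_le`).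

Lower bound: at a zero `θ₀` of `ψ''` of order `N - 2` the function `ψ` differs from its tangent by
`O(|s|^N)`, so for `k` close to `nψ'(θ₀)` the phase is almost constant on a window of width `η ~
n^(-1/N)`. A Fejér kernel with `M ~ 1/η`, normalised as an average of `M²` characters, yields an
integral that is at most `2π` times the supremum of the coefficients (`norm_integral_mul_fejer_le`)
and at least a multiple of `1/M` (`le_norm_integral_mul_fejer`).

Examples: `ψ'` is a sum of Poisson kernels. In degree one `ψ''` is a sine wave times a nonvanishing
factor. For a zero `(w-1)/(w+1)` and `τ = tan(θ/2)` the kernel is `Re((w+iτ)/(1+iwτ))`, whose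
coefficient of `τ^(2k)`, `k ≥ 1`, is `(-1)^k Re(w^(2k+1) - w^(2k-1))`; near `θ = π` the same holds
with `1/w`. Symmetry under conjugation removes odd powers, so the equations between odd powers of
the `w_j` express flatness at `θ = 0`, and the condition on inverses gives order exactly one at `π`
(`powersDecay_of_even`).

For the zeros built from roots of unity, `∏ (1 - conj λ_j z)` is a constant multiple of `1 -
κ(z-1)^N` with `κ = ζ^N`. This is flat at `z = 1`, and for small `κ` all other zeros of `ψ''` are
simple, by perturbation of the explicit curve for `κ = 0` (`exists_arg_rootZeros_aux`). -/

/-- The oscillating factor with phase `φ`. -/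
noncomputable def osc (φ : ℝ → ℝ) (x : ℝ) : ℂ := Complex.exp (Complex.I * φ x)

lemma norm_osc (φ : ℝ → ℝ) (x : ℝ) : ‖osc φ x‖ = 1 := by
  rw [osc, mul_comm, Complex.norm_exp_ofReal_mul_I]

lemma continuous_osc {φ : ℝ → ℝ} (hφ : Continuous φ) : Continuous (osc φ) := by
  unfold osc; fun_prop

lemma osc_neg (φ : ℝ → ℝ) (x : ℝ) : osc (fun x => -φ x) x = conj (osc φ x) := by
  simp [osc, ← Complex.exp_conj]

lemma hasDerivAt_osc {φ : ℝ → ℝ} {φ' x : ℝ} (h : HasDerivAt φ φ' x) :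
    HasDerivAt (osc φ) (Complex.I * φ' * osc φ x) x := by
  have := ((h.ofReal_comp).const_mul Complex.I).cexp
  unfold osc
  convert this using 1
  ring

lemma norm_integral_osc_neg (φ : ℝ → ℝ) (a b : ℝ) :
    ‖∫ x in a..b, osc (fun x => -φ x) x‖ = ‖∫ x in a..b, osc φ x‖ := by
  simp_rw [osc_neg]
  rw [intervalIntegral.intervalIntegral_eq_integral_uIoc,
    intervalIntegral.intervalIntegral_eq_integral_uIoc, integral_conj, norm_smul, norm_smul,
    RCLike.norm_conj]

/-! ### Van der Corput's lemma -/

/-- A continuous function bounded away from zero on an interval has constant sign there. -/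
lemma le_or_le_neg_of_le_abs {g : ℝ → ℝ} {a b μ : ℝ} (hg : Continuous g) (hμ : 0 < μ)
    (h : ∀ x ∈ Icc a b, μ ≤ |g x|) :
    (∀ x ∈ Icc a b, μ ≤ g x) ∨ (∀ x ∈ Icc a b, μ ≤ -g x) := by
  by_contra! hcon
  obtain ⟨⟨x, hx, hx'⟩, y, hy, hy'⟩ := hcon
  have hx2 : g x ≤ 0 := by
    rcases le_abs.1 (h x hx) with h1 | h1 <;> linarith
  have hy2 : 0 ≤ g y := by
    rcases le_abs.1 (h y hy) with h1 | h1 <;> linarith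
  obtain ⟨z, hz, hz0⟩ := intermediate_value_uIcc (hg.continuousOn (s := uIcc x y))
    (show (0 : ℝ) ∈ uIcc (g x) (g y) from Icc_subset_uIcc ⟨hx2, hy2⟩)
  have hzI : z ∈ Icc a b := (uIcc_subset_Icc hx hy) hz
  have := h z hzI
  rw [hz0, abs_zero] at this
  linarith

/-- Van der Corput's lemma for the first derivative and a convex phase. -/
lemma norm_integral_osc_le_of_convex {φ : ℝ → ℝ} (hφ : ContDiff ℝ ∞ φ) {a b μ : ℝ} (hab : a ≤ b)
    (hμ : 0 < μ) (h1 : ∀ x ∈ Icc a b, μ ≤ |deriv φ x|)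
    (h2 : ∀ x ∈ Icc a b, 0 ≤ deriv (deriv φ) x) :
    ‖∫ x in a..b, osc φ x‖ ≤ 4 / μ := by
  have hd1 : ContDiff ℝ ∞ (deriv φ) := (contDiff_infty_iff_deriv.1 hφ).2
  have hd2 : ContDiff ℝ ∞ (deriv (deriv φ)) := (contDiff_infty_iff_deriv.1 hd1).2
  have hD0 : ∀ x, HasDerivAt φ (deriv φ x) x := fun x =>
    ((hφ.differentiable (by simp)) x).hasDerivAt
  have hD1 : ∀ x, HasDerivAt (deriv φ) (deriv (deriv φ) x) x := fun x =>
    ((hd1.differentiable (by simp)) x).hasDerivAt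
  have hu : uIcc a b = Icc a b := uIcc_of_le hab
  have hne : ∀ x ∈ Icc a b, deriv φ x ≠ 0 := fun x hx h0 => by
    have := h1 x hx
    rw [h0, abs_zero] at this; linarith
  have hinv : ∀ x ∈ Icc a b, |(deriv φ x)⁻¹| ≤ μ⁻¹ := fun x hx => by
    rw [abs_inv]; exact inv_anti₀ hμ (h1 x hx)
  -- Integration by parts against `1/φ'`. Since `φ'' ≥ 0`, the derivative of `1/φ'` has constant
  -- sign, so its total variation telescopes to at most `2/μ`; the two boundary terms give the other
  -- `2/μ`.
  set u : ℝ → ℝ := fun x => (deriv φ x)⁻¹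
  set u' : ℝ → ℝ := fun x => -deriv (deriv φ) x / deriv φ x ^ 2
  have hud : ∀ x ∈ Icc a b, HasDerivAt u (u' x) x := fun x hx => (hD1 x).inv (hne x hx)
  have hu'c : ContinuousOn u' (Icc a b) := by
    refine ContinuousOn.div hd2.continuous.neg.continuousOn
      (hd1.continuous.pow 2).continuousOn fun x hx => pow_ne_zero 2 (hne x hx)
  have hu'i : IntervalIntegrable u' volume a b := (hu ▸ hu'c).intervalIntegrable
  have hint : ∫ x in a..b, u' x = u b - u a :=
    intervalIntegral.integral_eq_sub_of_hasDerivAt (fun x hx => hud x (hu ▸ hx)) hu'i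
  have hc := continuous_osc hφ.continuous
  have hparts := intervalIntegral.integral_mul_deriv_eq_deriv_mul (a := a) (b := b)
    (u := fun x => ((u x : ℝ) : ℂ)) (u' := fun x => ((u' x : ℝ) : ℂ)) (v := osc φ)
    (v' := fun x => Complex.I * deriv φ x * osc φ x)
    (fun x hx => (hud x (hu ▸ hx)).ofReal_comp) (fun x _ => hasDerivAt_osc (hD0 x))
    ⟨hu'i.1.ofReal, hu'i.2.ofReal⟩
    (Continuous.intervalIntegrable (by
      have := hd1.continuous
      fun_prop) _ _)
  have hleft : ∫ x in a..b, ((u x : ℝ) : ℂ) * (Complex.I * deriv φ x * osc φ x)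
      = Complex.I * ∫ x in a..b, osc φ x := by
    rw [← intervalIntegral.integral_const_mul]
    refine intervalIntegral.integral_congr fun x hx => ?_
    have : ((deriv φ x : ℝ) : ℂ) ≠ 0 := by exact_mod_cast hne x (hu ▸ hx)
    simp only [u, Complex.ofReal_inv]
    field_simp
  rw [hleft] at hparts
  have hrem : ‖∫ x in a..b, ((u' x : ℝ) : ℂ) * osc φ x‖ ≤ 2 / μ := by
    refine (intervalIntegral.norm_integral_le_integral_norm hab).trans ?_
    have : ∫ x in a..b, ‖((u' x : ℝ) : ℂ) * osc φ x‖ = ∫ x in a..b, -u' x := by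
      refine intervalIntegral.integral_congr fun x hx => ?_
      simp only [norm_mul, norm_osc, mul_one, Complex.norm_real, Real.norm_eq_abs]
      rw [abs_of_nonpos]
      simp only [u', neg_div]
      have := h2 x (hu ▸ hx)
      have : 0 ≤ deriv (deriv φ) x / deriv φ x ^ 2 := by positivity
      linarith
    rw [this, intervalIntegral.integral_neg, hint]
    have ha := abs_le.1 (hinv a (left_mem_Icc.2 hab))
    have hb := abs_le.1 (hinv b (right_mem_Icc.2 hab))
    simp only [u]
    rw [div_eq_mul_inv]
    linarith [ha.1, ha.2, hb.1, hb.2]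
  have hbd : ∀ x ∈ Icc a b, ‖((u x : ℝ) : ℂ) * osc φ x‖ ≤ 1 / μ := fun x hx => by
    rw [norm_mul, norm_osc, mul_one, Complex.norm_real, one_div]
    exact hinv x hx
  calc ‖∫ x in a..b, osc φ x‖ = ‖Complex.I * ∫ x in a..b, osc φ x‖ := by simp
    _ ≤ 1 / μ + 1 / μ + 2 / μ := by
      rw [hparts]
      refine (norm_sub_le _ _).trans (add_le_add ((norm_sub_le _ _).trans (add_le_add ?_ ?_)) hrem)
      · exact hbd b (right_mem_Icc.2 hab)
      · exact hbd a (left_mem_Icc.2 hab)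
    _ = 4 / μ := by ring

/-- A function whose increments dominate a linear function is large away from one point. -/
lemma exists_mul_abs_sub_le_abs {g : ℝ → ℝ} {a b μ : ℝ} (hab : a ≤ b) (hg : Continuous g)
    (h : ∀ x ∈ Icc a b, ∀ y ∈ Icc a b, x ≤ y → μ * (y - x) ≤ g y - g x) :
    ∃ x₀ ∈ Icc a b, ∀ x ∈ Icc a b, μ * |x - x₀| ≤ |g x| := by
  have ha : a ∈ Icc a b := left_mem_Icc.2 hab
  have hb : b ∈ Icc a b := right_mem_Icc.2 hab
  rcases le_total 0 (g a) with h0 | h0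
  · refine ⟨a, ha, fun x hx => ?_⟩
    rw [abs_of_nonneg (by linarith [hx.1])]
    refine le_trans ?_ (le_abs_self _)
    linarith [h a ha x hx hx.1]
  rcases le_total (g b) 0 with h1 | h1
  · refine ⟨b, hb, fun x hx => ?_⟩
    rw [abs_of_nonpos (by linarith [hx.2])]
    refine le_trans ?_ (neg_le_abs _)
    linarith [h x hx b hb hx.2]
  obtain ⟨x₀, hx₀, hz⟩ := intermediate_value_Icc hab hg.continuousOn (show (0 : ℝ) ∈ Icc _ _ from ⟨h0, h1⟩)
  refine ⟨x₀, hx₀, fun x hx => ?_⟩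
  rcases le_total x₀ x with hl | hl
  · rw [abs_of_nonneg (by linarith)]
    refine le_trans ?_ (le_abs_self _)
    linarith [h x₀ hx₀ x hx hl]
  · rw [abs_of_nonpos (by linarith)]
    refine le_trans ?_ (neg_le_abs _)
    linarith [h x hx x₀ hx₀ hl]

/-- The inductive mechanism of van der Corput's lemma: as `g` increases with slope at least `μ`, it
can be smaller than `μ * δ` only within `δ` of one point. That piece is estimated trivially by `2 *
δ`, the two outer pieces by `K` each. -/
lemma norm_integral_le_of_split {f : ℝ → ℂ} (hf : Continuous f) (hf1 : ∀ x, ‖f x‖ ≤ 1)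
    {g : ℝ → ℝ} {a b μ δ K : ℝ} (hab : a ≤ b) (hg : Differentiable ℝ g) (hμ : 0 ≤ μ)
    (hδ : 0 < δ) (hK : 0 ≤ K) (hg' : ∀ x ∈ Icc a b, μ ≤ deriv g x)
    (hint : ∀ c d, a ≤ c → c ≤ d → d ≤ b → (∀ x ∈ Icc c d, μ * δ ≤ |g x|) →
      ‖∫ x in c..d, f x‖ ≤ K) :
    ‖∫ x in a..b, f x‖ ≤ 2 * K + 2 * δ := by
  have hinc : ∀ x ∈ Icc a b, ∀ y ∈ Icc a b, x ≤ y → μ * (y - x) ≤ g y - g x :=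
    (convex_Icc a b).mul_sub_le_image_sub_of_le_deriv hg.continuous.continuousOn
      hg.differentiableOn fun x hx => hg' x (interior_subset hx)
  obtain ⟨x₀, hx₀, hlow⟩ := exists_mul_abs_sub_le_abs hab hg.continuous hinc
  set c := max a (x₀ - δ)
  set d := min b (x₀ + δ)
  have hac : a ≤ c := le_max_left _ _
  have hdb : d ≤ b := min_le_left _ _
  have hcx : c ≤ x₀ := max_le hx₀.1 (by linarith)
  have hxd : x₀ ≤ d := le_min hx₀.2 (by linarith)
  have hi : ∀ p q, IntervalIntegrable f volume p q := fun p q => hf.intervalIntegrable p q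
  have hleft : ‖∫ x in a..c, f x‖ ≤ K := by
    rcases le_total a (x₀ - δ) with h | h
    · refine hint a c le_rfl hac (hcx.trans hx₀.2) fun x hx => ?_
      have hxc : x ≤ x₀ - δ := by simpa [c, max_eq_right h] using hx.2
      refine le_trans ?_ (hlow x ⟨hx.1, hx.2.trans (hcx.trans hx₀.2)⟩)
      gcongr
      rw [abs_of_nonpos (by linarith)]; linarith
    · simp [c, max_eq_left h, hK]
  have hright : ‖∫ x in d..b, f x‖ ≤ K := by
    rcases le_total (x₀ + δ) b with h | h
    · refine hint d b (hx₀.1.trans hxd) hdb le_rfl fun x hx => ?_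
      have hxc : x₀ + δ ≤ x := by simpa [d, min_eq_right h] using hx.1
      refine le_trans ?_ (hlow x ⟨(hx₀.1.trans hxd).trans hx.1, hx.2⟩)
      gcongr
      rw [abs_of_nonneg (by linarith)]; linarith
    · simp [d, min_eq_left h, hK]
  have hmid : ‖∫ x in c..d, f x‖ ≤ 2 * δ := by
    have := intervalIntegral.norm_integral_le_of_norm_le_const (a := c) (b := d) (f := f) (C := 1)
      fun x _ => hf1 x
    rw [one_mul, abs_of_nonneg (by linarith)] at this
    have h1 : d ≤ x₀ + δ := min_le_right _ _
    have h2 : x₀ - δ ≤ c := le_max_right _ _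
    linarith
  rw [← intervalIntegral.integral_add_adjacent_intervals (hi a c) (hi c b),
    ← intervalIntegral.integral_add_adjacent_intervals (hi c d) (hi d b)]
  have h1 := norm_add_le (∫ x in a..c, f x) ((∫ x in c..d, f x) + ∫ x in d..b, f x)
  have h2 := norm_add_le (∫ x in c..d, f x) (∫ x in d..b, f x)
  linarith

/-- A bound for oscillatory integrals under a one-sided condition on the `j`-th derivative extends
to a two-sided condition. -/
lemma norm_integral_osc_le_of_le_abs {j : ℕ} {C : ℝ}
    (H : ∀ φ : ℝ → ℝ, ContDiff ℝ ∞ φ → ∀ a b μ : ℝ, a ≤ b → 0 < μ →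
      (∀ x ∈ Icc a b, μ ≤ iteratedDeriv j φ x) →
      ‖∫ x in a..b, osc φ x‖ ≤ C * μ ^ (-(1 / (j : ℝ))))
    (φ : ℝ → ℝ) (hφ : ContDiff ℝ ∞ φ) (a b μ : ℝ) (hab : a ≤ b) (hμ : 0 < μ)
    (h : ∀ x ∈ Icc a b, μ ≤ |iteratedDeriv j φ x|) :
    ‖∫ x in a..b, osc φ x‖ ≤ C * μ ^ (-(1 / (j : ℝ))) := by
  have hc : Continuous (iteratedDeriv j φ) :=
    hφ.continuous_iteratedDeriv j (by exact_mod_cast le_top)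
  rcases le_or_le_neg_of_le_abs hc hμ h with h1 | h1
  · exact H φ hφ a b μ hab hμ h1
  · rw [← norm_integral_osc_neg]
    refine H _ hφ.neg a b μ hab hμ fun x hx => ?_
    rw [iteratedDeriv_fun_neg]
    exact h1 x hx

/-- Van der Corput's lemma for derivatives of order at least two. -/
theorem exists_vanDerCorput (j : ℕ) (hj : 2 ≤ j) :
    ∃ C : ℝ, 0 < C ∧ ∀ φ : ℝ → ℝ, ContDiff ℝ ∞ φ → ∀ a b μ : ℝ, a ≤ b → 0 < μ →
      (∀ x ∈ Icc a b, μ ≤ |iteratedDeriv j φ x|) →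
      ‖∫ x in a..b, osc φ x‖ ≤ C * μ ^ (-(1 / (j : ℝ))) := by
  induction j, hj using Nat.le_induction with
  | base =>
    refine ⟨10, by norm_num, norm_integral_osc_le_of_le_abs fun φ hφ a b μ hab hμ h => ?_⟩
    have hd1 : ContDiff ℝ ∞ (deriv φ) := (contDiff_infty_iff_deriv.1 hφ).2
    rw [iteratedDeriv_succ, iteratedDeriv_one] at h
    have hδ : 0 < μ ^ (-(1 / ((2 : ℕ) : ℝ))) := Real.rpow_pos_of_pos hμ _
    -- This `δ` balances the outer bound `4 / (μ * δ)` with the trivial one: `2 * 4 + 2 = 10`.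
    set δ := μ ^ (-(1 / ((2 : ℕ) : ℝ))) with hδdef
    have hμδ : 4 / (μ * δ) = 4 * δ := by
      have : δ * δ = μ⁻¹ := by
        rw [hδdef, ← Real.rpow_add hμ, ← Real.rpow_neg_one]; norm_num
      field_simp
      rw [pow_two, this]; field_simp
    have := norm_integral_le_of_split (continuous_osc hφ.continuous)
      (fun x => (norm_osc φ x).le) hab (hd1.differentiable (by simp)) hμ.le hδ
      (K := 4 * δ) (by positivity) h fun c d hac hcd hdb hh => by
        rw [← hμδ]
        exact norm_integral_osc_le_of_convex hφ hcd (by positivity) hh fun x hx =>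
          hμ.le.trans (h x ⟨hac.trans hx.1, hx.2.trans hdb⟩)
    linarith
  | succ j hj ih =>
    obtain ⟨C, hC, ih⟩ := ih
    refine ⟨2 * C + 2, by positivity,
      norm_integral_osc_le_of_le_abs fun φ hφ a b μ hab hμ h => ?_⟩
    rw [iteratedDeriv_succ] at h
    have hδ : 0 < μ ^ (-(1 / ((j + 1 : ℕ) : ℝ))) := Real.rpow_pos_of_pos hμ _
    -- Chosen so that `(μ * δ) ^ (-1/j) = δ`: both parts of the split then have size `δ`.
    set δ := μ ^ (-(1 / ((j + 1 : ℕ) : ℝ))) with hδdef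
    have hjp : (0 : ℝ) < j := by exact_mod_cast (by omega : 0 < j)
    have hμδ : (μ * δ) ^ (-(1 / (j : ℝ))) = δ := by
      have : μ * δ = μ ^ (1 - 1 / ((j + 1 : ℕ) : ℝ)) := by
        rw [hδdef, sub_eq_add_neg, Real.rpow_add hμ, Real.rpow_one]
      rw [this, ← Real.rpow_mul hμ.le, hδdef]
      congr 1
      push_cast
      field_simp
      ring
    have hdiff : Differentiable ℝ (iteratedDeriv j φ) :=
      hφ.differentiable_iteratedDeriv j (by exact_mod_cast WithTop.coe_lt_top _)
    have := norm_integral_le_of_split (continuous_osc hφ.continuous)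
      (fun x => (norm_osc φ x).le) hab hdiff hμ.le hδ
      (K := C * δ) (by positivity) h fun c d hac hcd hdb hh => by
        have := ih φ hφ c d (μ * δ) hcd (by positivity) hh
        rwa [hμδ] at this
    linarith

/-! ### Upper bound -/

lemma iteratedDeriv_phase {ψ : ℝ → ℝ} (hψ : ContDiff ℝ ∞ ψ) (c d : ℝ) (j : ℕ) (x : ℝ) :
    iteratedDeriv (j + 2) (fun x => c * ψ x - d * x) x = c * iteratedDeriv (j + 2) ψ x := by
  have hd1 : ContDiff ℝ ∞ (deriv ψ) := (contDiff_infty_iff_deriv.1 hψ).2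
  have h1 : deriv (fun x => c * ψ x - d * x) = fun x => c * deriv ψ x - d := by
    ext x
    have := ((((hψ.differentiable (by simp)) x).hasDerivAt).const_mul c).sub
      ((hasDerivAt_id x).const_mul d)
    exact (this.congr_deriv (by simp)).deriv
  have h2 : deriv (fun x => c * deriv ψ x - d) = fun x => c * deriv (deriv ψ) x := by
    ext x
    have := ((((hd1.differentiable (by simp)) x).hasDerivAt).const_mul c).sub_const d
    exact this.deriv
  rw [iteratedDeriv_succ', iteratedDeriv_succ', h1, h2, iteratedDeriv_const_mul_field,
    iteratedDeriv_succ', iteratedDeriv_succ']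

/-- If at each point some derivative of `ψ` of order between `2` and `N` is nonzero, then the
oscillatory integrals with phase `n ψ - k θ` are `O(n^(-1/N))`, uniformly in `k`. -/
theorem exists_norm_integral_osc_le {ψ : ℝ → ℝ} (hψ : ContDiff ℝ ∞ ψ) {N : ℕ} (hN : 2 ≤ N)
    (h : ∀ θ, ∃ k ≤ N - 2, iteratedDeriv (k + 2) ψ θ ≠ 0) {a b : ℝ} (hab : a ≤ b) :
    ∃ C : ℝ, 0 < C ∧ ∀ n : ℕ, 1 ≤ n → ∀ d : ℝ,
      ‖∫ x in a..b, osc (fun x => n * ψ x - d * x) x‖ ≤ C * (n : ℝ) ^ (-(1 / (N : ℝ))) := by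
  choose k hkN hk using h
  have hcont : ∀ j, Continuous (iteratedDeriv j ψ) := fun j =>
    hψ.continuous_iteratedDeriv j (by exact_mod_cast le_top)
  -- On `U x` the derivative of order `k x + 2` is at least half its value at `x`; compactness gives
  -- a finite partition of `[a, b]` subordinate to these sets.
  set U : ℝ → Set ℝ := fun x =>
    {y | |iteratedDeriv (k x + 2) ψ x| / 2 < |iteratedDeriv (k x + 2) ψ y|}
  have hU : ∀ x, IsOpen (U x) := fun x => isOpen_lt continuous_const (hcont _).abs
  have hxU : ∀ x, x ∈ U x := fun x => half_lt_self (abs_pos.2 (hk x))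
  obtain ⟨t, ht0, htm, ⟨m, hm⟩, hti⟩ := exists_monotone_Icc_subset_open_cover_Icc hab
    (c := fun x : ℝ => (Subtype.val ⁻¹' (U x) : Set (Icc a b)))
    (fun x => (hU x).preimage continuous_subtype_val)
    (fun y _ => mem_iUnion.2 ⟨y, hxU y⟩)
  have hpiece : ∀ i, ∃ C : ℝ, 0 < C ∧ ∀ n : ℕ, 1 ≤ n → ∀ d : ℝ,
      ‖∫ x in (t i : ℝ)..(t (i + 1) : ℝ), osc (fun x => n * ψ x - d * x) x‖
        ≤ C * (n : ℝ) ^ (-(1 / (N : ℝ))) := by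
    intro i
    obtain ⟨x, hx⟩ := hti i
    obtain ⟨C, hC, hvdc⟩ := exists_vanDerCorput (k x + 2) (by omega)
    set μ := |iteratedDeriv (k x + 2) ψ x| / 2 with hμdef
    have hμ : 0 < μ := half_pos (abs_pos.2 (hk x))
    refine ⟨C * μ ^ (-(1 / ((k x + 2 : ℕ) : ℝ))), by positivity, fun n hn d => ?_⟩
    have hn1 : (1 : ℝ) ≤ n := by exact_mod_cast hn
    have hφ : ContDiff ℝ ∞ (fun x => n * ψ x - d * x) := by fun_prop
    have := hvdc _ hφ (t i) (t (i + 1)) (n * μ) (htm (Nat.le_succ i)) (by positivity) (by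
      intro y hy
      rw [iteratedDeriv_phase hψ, abs_mul, abs_of_nonneg (by positivity : (0 : ℝ) ≤ n)]
      have hyI : y ∈ Icc a b := ⟨(t i).2.1.trans hy.1, hy.2.trans (t (i + 1)).2.2⟩
      have : (⟨y, hyI⟩ : Icc a b) ∈ Icc (t i) (t (i + 1)) := hy
      have := hx this
      have hyU : μ < |iteratedDeriv (k x + 2) ψ y| := this
      gcongr)
    refine this.trans ?_
    rw [Real.mul_rpow (by positivity) hμ.le, mul_comm ((n : ℝ) ^ _), ← mul_assoc]
    have := hkN x
    gcongr
    omega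
  choose C hC hCb using hpiece
  -- The summand `1` keeps the constant positive even if `m = 0`.
  refine ⟨∑ i ∈ Finset.range m, C i + 1, ?_, fun n hn d => ?_⟩
  · have : 0 ≤ ∑ i ∈ Finset.range m, C i := Finset.sum_nonneg fun i _ => (hC i).le
    linarith
  have hc : Continuous (osc (fun x => n * ψ x - d * x)) :=
    continuous_osc (by have := hψ.continuous; fun_prop)
  have hsum := intervalIntegral.sum_integral_adjacent_intervals (n := m) (a := fun i => (t i : ℝ))
    (f := osc (fun x => n * ψ x - d * x)) (μ := volume) fun i _ => hc.intervalIntegrable _ _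
  simp only [ht0, hm m le_rfl] at hsum
  rw [← hsum, add_mul, Finset.sum_mul]
  have h0 : 0 ≤ 1 * (n : ℝ) ^ (-(1 / (N : ℝ))) := by positivity
  have := (norm_sum_le (Finset.range m) fun i =>
    ∫ x in (t i : ℝ)..(t (i + 1) : ℝ), osc (fun x => n * ψ x - d * x) x).trans
      (Finset.sum_le_sum fun i _ => hCb i n hn d)
  linarith

/-! ### The Fejér kernel -/

/-- The nonnegative kernel `|∑_{j < M} exp (ijs)|² / M²`. -/
noncomputable def fejer (M : ℕ) (s : ℝ) : ℝ :=
  ‖∑ j ∈ Finset.range M, Complex.exp (Complex.I * s) ^ j‖ ^ 2 / (M : ℝ) ^ 2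

lemma fejer_nonneg (M : ℕ) (s : ℝ) : 0 ≤ fejer M s := by unfold fejer; positivity

lemma continuous_fejer (M : ℕ) : Continuous (fejer M) := by unfold fejer; fun_prop

lemma ofReal_fejer (M : ℕ) (s : ℝ) : (fejer M s : ℂ) =
    (∑ j ∈ Finset.range M, ∑ l ∈ Finset.range M,
      Complex.exp (Complex.I * (((j : ℤ) - (l : ℤ) : ℤ) : ℂ) * s)) / (M : ℂ) ^ 2 := by
  unfold fejer
  push_cast
  rw [← Complex.mul_conj', map_sum, Finset.sum_mul_sum]
  congr 1
  refine Finset.sum_congr rfl fun j _ => Finset.sum_congr rfl fun l _ => ?_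
  rw [map_pow, ← Complex.exp_conj, ← Complex.exp_nat_mul, ← Complex.exp_nat_mul, ← Complex.exp_add]
  congr 1
  simp
  ring

/-- The geometric sum times `e^{is} - 1` has modulus at most `2`, and Jordan's inequality bounds
`|e^{is} - 1|` below by `2|s|/π`. -/
lemma fejer_mul_sq_le {M : ℕ} {s : ℝ} (hs : |s| ≤ Real.pi) :
    fejer M s * s ^ 2 ≤ Real.pi ^ 2 / (M : ℝ) ^ 2 := by
  unfold fejer
  rw [div_mul_eq_mul_div]
  gcongr
  set D := ∑ j ∈ Finset.range M, Complex.exp (Complex.I * s) ^ j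
  have h1 : ‖D‖ * ‖Complex.exp (Complex.I * s) - 1‖ ≤ 2 := by
    rw [← norm_mul, geom_sum_mul]
    refine (norm_sub_le _ _).trans ?_
    rw [norm_pow, mul_comm, Complex.norm_exp_ofReal_mul_I]
    norm_num
  have h2 : 2 / Real.pi * |s| ≤ ‖Complex.exp (Complex.I * s) - 1‖ := by
    rw [Complex.norm_exp_I_mul_ofReal_sub_one, norm_mul, Real.norm_two, Real.norm_eq_abs]
    have := Real.mul_abs_le_abs_sin (x := s / 2) (by
      rw [abs_div, abs_two]; linarith)
    rw [abs_div, abs_two] at this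
    linarith
  have h3 : ‖D‖ * |s| ≤ Real.pi := by
    have h4 : ‖D‖ * (2 / Real.pi * |s|) ≤ 2 := (mul_le_mul_of_nonneg_left h2 (norm_nonneg _)).trans h1
    have hpi := Real.pi_pos
    calc ‖D‖ * |s| = ‖D‖ * (2 / Real.pi * |s|) * (Real.pi / 2) := by field_simp
      _ ≤ 2 * (Real.pi / 2) := by gcongr
      _ = Real.pi := by ring
  calc ‖D‖ ^ 2 * s ^ 2 = (‖D‖ * |s|) ^ 2 := by rw [mul_pow, sq_abs]
    _ ≤ Real.pi ^ 2 := by gcongr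

lemma integral_exp_int (m : ℤ) : ∫ s in (-Real.pi)..Real.pi, Complex.exp (Complex.I * (m : ℂ) * s)
    = if m = 0 then (2 * Real.pi : ℂ) else 0 := by
  split_ifs with h
  · simp [h]; ring
  · have hne : Complex.I * (m : ℂ) ≠ 0 := mul_ne_zero Complex.I_ne_zero (by exact_mod_cast h)
    rw [integral_exp_mul_complex hne]
    have : Complex.exp (Complex.I * m * (Real.pi : ℝ)) =
        Complex.exp (Complex.I * m * ((-Real.pi : ℝ) : ℂ)) := by
      rw [Complex.exp_eq_exp_iff_exists_int]
      exact ⟨m, by push_cast; ring⟩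
    rw [this, sub_self, zero_div]

lemma integral_fejer {M : ℕ} (hM : M ≠ 0) :
    ∫ s in (-Real.pi)..Real.pi, fejer M s = 2 * Real.pi / M := by
  have hM' : (M : ℂ) ≠ 0 := by exact_mod_cast hM
  have : ((∫ s in (-Real.pi)..Real.pi, fejer M s : ℝ) : ℂ) = 2 * Real.pi / M := by
    rw [← intervalIntegral.integral_ofReal]
    simp_rw [ofReal_fejer]
    rw [intervalIntegral.integral_div, intervalIntegral.integral_finsetSum]
    · have : ∀ j ∈ Finset.range M, ∫ s in (-Real.pi)..Real.pi, ∑ l ∈ Finset.range M,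
          Complex.exp (Complex.I * (((j : ℤ) - (l : ℤ) : ℤ) : ℂ) * s) = 2 * Real.pi := by
        intro j hj
        rw [intervalIntegral.integral_finsetSum]
        · simp_rw [integral_exp_int, sub_eq_zero, Nat.cast_inj]
          rw [Finset.sum_ite_eq, if_pos hj]
        · intro l _
          exact Continuous.intervalIntegrable (by fun_prop) _ _
      rw [Finset.sum_congr rfl this]
      simp
      field_simp
    · intro j _
      exact Continuous.intervalIntegrable (by fun_prop) _ _
  exact_mod_cast this

lemma integral_inv_sq_add_sq_le {η : ℝ} (hη : 0 < η) {a b : ℝ} :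
    ∫ s in a..b, (s ^ 2 + η ^ 2)⁻¹ ≤ Real.pi / η := by
  have hd : ∀ s ∈ uIcc a b, HasDerivAt (fun s => Real.arctan (s / η) / η) (s ^ 2 + η ^ 2)⁻¹ s := by
    intro s _
    have := (((hasDerivAt_id s).div_const η).arctan).div_const η
    refine this.congr_deriv ?_
    simp only [id]
    have : η ^ 2 + s ^ 2 ≠ 0 := by positivity
    field_simp
    ring
  rw [intervalIntegral.integral_eq_sub_of_hasDerivAt hd]
  · have h1 := Real.arctan_lt_pi_div_two (b / η)
    have h2 := Real.neg_pi_div_two_lt_arctan (a / η)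
    rw [← sub_div]
    gcongr
    linarith
  · refine Continuous.intervalIntegrable ?_ _ _
    refine Continuous.inv₀ (by fun_prop) fun s => by positivity

/-- A lower bound for the integral against the Fejér kernel of a unimodular function with nearly
constant argument near the origin. -/
lemma le_norm_integral_mul_fejer {ρ : ℝ → ℝ} (hρ : Continuous ρ) {η : ℝ} (hη : 0 < η)
    (h : ∀ s, |s| ≤ η → |ρ s| ≤ 1) {M : ℕ} (hM : 6 * Real.pi ^ 2 ≤ M * η) :
    Real.pi / (2 * M) ≤ ‖∫ s in (-Real.pi)..Real.pi, osc ρ s * fejer M s‖ := by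
  have hpi := Real.pi_pos
  have hMpos : (0 : ℝ) < M := by
    by_contra! hcon
    nlinarith [mul_nonneg hη.le (sub_nonneg.2 hcon), pow_pos hpi 2]
  have hM0 : M ≠ 0 := by exact_mod_cast hMpos.ne'
  have hint : IntervalIntegrable (fun s => osc ρ s * fejer M s) volume (-Real.pi) Real.pi :=
    ((continuous_osc hρ).mul (Complex.continuous_ofReal.comp (continuous_fejer M))).intervalIntegrable _ _
  have hcr : Continuous fun s => (s ^ 2 + η ^ 2)⁻¹ :=
    Continuous.inv₀ (by fun_prop) fun s => by positivity
  have hre : ∫ s in (-Real.pi)..Real.pi, (osc ρ s * fejer M s).re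
      = (∫ s in (-Real.pi)..Real.pi, osc ρ s * fejer M s).re := by
    have := Complex.reCLM.intervalIntegral_comp_comm hint
    simpa using this
  -- On the window `cos ρ ≥ 1/2`; off it `cos ρ ≥ -1`, and the loss of `3/2` kernels is covered by
  -- the tail bound because `s² + η² ≤ 2s²` there. A single minorant on the whole interval avoids
  -- splitting the integral.
  have hpt : ∀ s ∈ Icc (-Real.pi) Real.pi,
      1 / 2 * fejer M s - 3 * Real.pi ^ 2 / (M : ℝ) ^ 2 * (s ^ 2 + η ^ 2)⁻¹
        ≤ (osc ρ s * fejer M s).re := by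
    intro s hs
    have hval : (osc ρ s * fejer M s).re = Real.cos (ρ s) * fejer M s := by
      rw [Complex.re_mul_ofReal, osc, mul_comm Complex.I, Complex.exp_ofReal_mul_I_re]
    rw [hval]
    have hf := fejer_nonneg M s
    rcases le_or_gt |s| η with hle | hlt
    · have h1 := Real.one_sub_sq_div_two_le_cos (x := ρ s)
      have h2 : ρ s ^ 2 ≤ 1 := (sq_le_one_iff_abs_le_one _).2 (h s hle)
      have h3 : 1 / 2 * fejer M s ≤ Real.cos (ρ s) * fejer M s := by gcongr; linarith
      have h4 : 0 ≤ 3 * Real.pi ^ 2 / (M : ℝ) ^ 2 * (s ^ 2 + η ^ 2)⁻¹ := by positivity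
      linarith
    · have h1 := Real.neg_one_le_cos (ρ s)
      have h2 : -1 * fejer M s ≤ Real.cos (ρ s) * fejer M s := by gcongr
      have h3 : 3 / 2 * fejer M s ≤ 3 * Real.pi ^ 2 / (M : ℝ) ^ 2 * (s ^ 2 + η ^ 2)⁻¹ := by
        rw [le_mul_inv_iff₀ (by positivity)]
        have hs2 : η ^ 2 ≤ s ^ 2 := by
          rw [← sq_abs s]; gcongr
        have := fejer_mul_sq_le (M := M) (abs_le.2 hs)
        calc 3 / 2 * fejer M s * (s ^ 2 + η ^ 2) ≤ 3 / 2 * fejer M s * (s ^ 2 + s ^ 2) := by gcongr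
          _ = 3 * (fejer M s * s ^ 2) := by ring
          _ ≤ 3 * (Real.pi ^ 2 / (M : ℝ) ^ 2) := by gcongr
          _ = _ := by ring
      linarith
  have hmono := intervalIntegral.integral_mono_on (μ := volume)
    (by linarith : -Real.pi ≤ Real.pi)
    (Continuous.intervalIntegrable
      (((continuous_fejer M).const_mul _).sub (hcr.const_mul _)) _ _)
    (Continuous.intervalIntegrable (Complex.continuous_re.comp
      ((continuous_osc hρ).mul (Complex.continuous_ofReal.comp (continuous_fejer M)))) _ _) hpt
  have hmono' : 1 / 2 * (2 * Real.pi / M) - 3 * Real.pi ^ 2 / (M : ℝ) ^ 2 * (Real.pi / η)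
      ≤ ∫ s in (-Real.pi)..Real.pi, (osc ρ s * fejer M s).re := by
    refine le_trans ?_ hmono
    simp only [Pi.sub_apply]
    rw [intervalIntegral.integral_sub
      (((continuous_fejer M).const_mul _).intervalIntegrable _ _)
      ((hcr.const_mul _).intervalIntegrable _ _), intervalIntegral.integral_const_mul,
      intervalIntegral.integral_const_mul, integral_fejer hM0]
    gcongr
    exact integral_inv_sq_add_sq_le hη
  rw [hre] at hmono'
  refine le_trans ?_ (hmono'.trans (Complex.re_le_norm _))
  -- The main term is `π/M`; the hypothesis `6π² ≤ Mη` says exactly that the tail consumes at most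
  -- half of it.
  have : 3 * Real.pi ^ 2 / (M : ℝ) ^ 2 * (Real.pi / η) ≤ Real.pi / (2 * M) := by
    rw [div_mul_div_comm, div_le_div_iff₀ (by positivity) (by positivity)]
    calc 3 * Real.pi ^ 2 * Real.pi * (2 * M) = Real.pi * M * (6 * Real.pi ^ 2) := by ring
      _ ≤ Real.pi * M * (M * η) := by gcongr
      _ = _ := by ring
  have h2 : 1 / 2 * (2 * Real.pi / M) = Real.pi / (2 * M) + Real.pi / (2 * M) := by
    field_simp; ring
  linarith

/-- Integrals against modulated and translated Fejér kernels are controlled by the Fourier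
coefficients. -/
lemma norm_integral_mul_fejer_le {F : ℝ → ℂ} (hF : Continuous F)
    (hper : Function.Periodic F (2 * Real.pi)) {S : ℝ}
    (hS : ∀ k : ℤ, ‖∫ θ in (0 : ℝ)..(2 * Real.pi), F θ * Complex.exp (-(Complex.I * k * θ))‖ ≤ S)
    {M : ℕ} (hM : M ≠ 0) (k : ℤ) (θ₀ : ℝ) :
    ‖∫ s in (-Real.pi)..Real.pi,
      F (θ₀ + s) * Complex.exp (-(Complex.I * k * (θ₀ + s : ℝ))) * fejer M s‖ ≤ S := by
  -- A character `e^{ims}` only shifts the frequency to `k - m`, and the translation by `θ₀` costs a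
  -- unimodular factor. The shifted frequency may be negative, hence the bound `hS` over `ℤ`.
  have key : ∀ m : ℤ, ‖∫ s in (-Real.pi)..Real.pi,
      F (θ₀ + s) * Complex.exp (-(Complex.I * k * (θ₀ + s : ℝ))) *
        Complex.exp (Complex.I * m * s)‖ ≤ S := by
    intro m
    set G : ℝ → ℂ := fun θ => F θ * Complex.exp (-(Complex.I * ((k - m : ℤ) : ℂ) * θ)) with hG
    have hGper : Function.Periodic G (2 * Real.pi) := by
      intro θ
      simp only [hG, hper θ]
      congr 1
      rw [Complex.exp_eq_exp_iff_exists_int]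
      exact ⟨-(k - m), by push_cast; ring⟩
    have hs : ∀ s : ℝ, F (θ₀ + s) * Complex.exp (-(Complex.I * k * (θ₀ + s : ℝ))) *
        Complex.exp (Complex.I * m * s) = Complex.exp (-(Complex.I * m * θ₀)) * G (θ₀ + s) := by
      intro s
      simp only [hG]
      rw [mul_assoc, ← Complex.exp_add, mul_left_comm, ← Complex.exp_add]
      congr 2
      push_cast
      ring
    simp_rw [hs]
    rw [intervalIntegral.integral_const_mul, intervalIntegral.integral_comp_add_left (f := G),
      norm_mul]
    have h1 : ‖Complex.exp (-(Complex.I * m * θ₀))‖ = 1 := by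
      rw [Complex.norm_exp]; simp
    have h2 : θ₀ + Real.pi = (θ₀ + -Real.pi) + 2 * Real.pi := by ring
    rw [h1, one_mul, h2, hGper.intervalIntegral_add_eq _ 0, zero_add]
    exact hS (k - m)
  have hM' : (0 : ℝ) < M := by exact_mod_cast Nat.pos_of_ne_zero hM
  have hsplit : ∀ s : ℝ, F (θ₀ + s) * Complex.exp (-(Complex.I * k * (θ₀ + s : ℝ))) * fejer M s =
      (∑ j ∈ Finset.range M, ∑ l ∈ Finset.range M,
        F (θ₀ + s) * Complex.exp (-(Complex.I * k * (θ₀ + s : ℝ))) *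
        Complex.exp (Complex.I * (((j : ℤ) - (l : ℤ) : ℤ) : ℂ) * s)) / (M : ℂ) ^ 2 := by
    intro s
    simp_rw [← Finset.mul_sum]
    rw [ofReal_fejer]
    ring
  simp_rw [hsplit]
  have hcF : Continuous fun s => F (θ₀ + s) := hF.comp (by fun_prop)
  rw [intervalIntegral.integral_div, intervalIntegral.integral_finsetSum]
  · have h1 : ∀ j ∈ Finset.range M, ‖∫ s in (-Real.pi)..Real.pi, ∑ l ∈ Finset.range M,
        F (θ₀ + s) * Complex.exp (-(Complex.I * k * (θ₀ + s : ℝ))) *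
        Complex.exp (Complex.I * (((j : ℤ) - (l : ℤ) : ℤ) : ℂ) * s)‖ ≤ M * S := by
      intro j _
      rw [intervalIntegral.integral_finsetSum]
      · refine (norm_sum_le_of_le _ fun l _ => key _).trans ?_
        simp
      · intro l _
        exact Continuous.intervalIntegrable (by fun_prop) _ _
    rw [norm_div, div_le_iff₀ (by rw [norm_pow, Complex.norm_natCast]; positivity)]
    refine (norm_sum_le_of_le _ h1).trans ?_
    simp
    apply le_of_eq; ring
  · intro j _
    exact Continuous.intervalIntegrable (by fun_prop) _ _

/-! ### Taylor bounds -/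

lemma exists_abs_le_pow_succ {f : ℝ → ℝ} (hf : Differentiable ℝ f) {x₀ : ℝ} (h0 : f x₀ = 0)
    {m : ℕ} {C : ℝ} (h : ∀ s, |s| ≤ 1 → |deriv f (x₀ + s)| ≤ C * |s| ^ m) :
    ∀ s, |s| ≤ 1 → |f (x₀ + s)| ≤ C * |s| ^ (m + 1) := by
  intro s hs
  have hC : 0 ≤ C := by
    have := (abs_nonneg _).trans (h 1 (by simp))
    simpa using this
  have := Convex.norm_image_sub_le_of_norm_deriv_le (f := f) (s := Metric.closedBall x₀ |s|)
    (x := x₀) (y := x₀ + s) (C := C * |s| ^ m) (fun x _ => hf x) (fun x hx => by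
      rw [Metric.mem_closedBall, Real.dist_eq] at hx
      have := h (x - x₀) (hx.trans hs)
      rw [add_sub_cancel] at this
      refine this.trans ?_
      gcongr) (convex_closedBall _ _) (by simp) (by simp)
  simp only [h0, sub_zero, add_sub_cancel_left, Real.norm_eq_abs] at this
  rw [pow_succ, ← mul_assoc]
  exact this

lemma exists_abs_le_pow_of_iteratedDeriv_eq_zero {m : ℕ} : ∀ {f : ℝ → ℝ}, ContDiff ℝ ∞ f →
    ∀ {x₀ : ℝ}, (∀ i < m, iteratedDeriv i f x₀ = 0) →
    ∃ C : ℝ, ∀ s, |s| ≤ 1 → |f (x₀ + s)| ≤ C * |s| ^ m := by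
  induction m with
  | zero =>
    intro f hf x₀ _
    obtain ⟨C, hC⟩ := (isCompact_closedBall x₀ 1).exists_bound_of_continuousOn
      hf.continuous.continuousOn
    exact ⟨C, fun s hs => by simpa using hC (x₀ + s) (by simpa using hs)⟩
  | succ m ih =>
    intro f hf x₀ h
    obtain ⟨C, hC⟩ := ih (contDiff_infty_iff_deriv.1 hf).2 (x₀ := x₀) fun i hi => by
      rw [← iteratedDeriv_succ']; exact h (i + 1) (by omega)
    exact ⟨C, exists_abs_le_pow_succ (hf.differentiable (by simp)) (by simpa using h 0 (by omega)) hC⟩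

/-- The bound `C|s|^(N-2)` for `ψ''` passes through the mean value inequality twice, each time
gaining one power of `|s|` with the same constant. -/
lemma exists_abs_sub_linear_le {ψ : ℝ → ℝ} (hψ : ContDiff ℝ ∞ ψ) {N : ℕ} (hN : 2 ≤ N) {θ₀ : ℝ}
    (h : ∀ i < N - 2, iteratedDeriv i (iteratedDeriv 2 ψ) θ₀ = 0) :
    ∃ C : ℝ, 0 ≤ C ∧ ∀ s, |s| ≤ 1 →
      |ψ (θ₀ + s) - ψ θ₀ - deriv ψ θ₀ * s| ≤ C * |s| ^ N := by
  have hd1 : ContDiff ℝ ∞ (deriv ψ) := (contDiff_infty_iff_deriv.1 hψ).2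
  have hd2 : ContDiff ℝ ∞ (deriv (deriv ψ)) := (contDiff_infty_iff_deriv.1 hd1).2
  have e2 : iteratedDeriv 2 ψ = deriv (deriv ψ) := by rw [iteratedDeriv_succ, iteratedDeriv_one]
  rw [e2] at h
  obtain ⟨C, hC⟩ := exists_abs_le_pow_of_iteratedDeriv_eq_zero hd2 h
  have hC0 : 0 ≤ C := by
    have := (abs_nonneg _).trans (hC 1 (by simp))
    simpa using this
  have e1 : deriv (fun x => deriv ψ x - deriv ψ θ₀) = deriv (deriv ψ) := by
    ext x; rw [deriv_sub_const]
  have h1 := exists_abs_le_pow_succ (f := fun x => deriv ψ x - deriv ψ θ₀)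
    ((hd1.differentiable (by simp)).sub_const _) (x₀ := θ₀) (by simp) (by rw [e1]; exact hC)
  have e0 : deriv (fun x => ψ x - ψ θ₀ - deriv ψ θ₀ * (x - θ₀)) =
      fun x => deriv ψ x - deriv ψ θ₀ := by
    ext x
    have := (((hψ.differentiable (by simp) x).hasDerivAt.sub_const (ψ θ₀))).sub
      (((hasDerivAt_id x).sub_const θ₀).const_mul (deriv ψ θ₀))
    exact (this.congr_deriv (by simp)).deriv
  have h0 := exists_abs_le_pow_succ (f := fun x => ψ x - ψ θ₀ - deriv ψ θ₀ * (x - θ₀))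
    (((hψ.differentiable (by simp)).sub_const _).sub (by fun_prop)) (x₀ := θ₀) (by simp)
    (by rw [e0]; exact h1)
  refine ⟨C, hC0, fun s hs => ?_⟩
  have := h0 s hs
  rw [show N - 2 + 1 + 1 = N by omega] at this
  simpa using this

/-! ### Blaschke products and their Fourier coefficients -/

lemma one_sub_conj_mul_ne_zero {a z : ℂ} (ha : ‖a‖ < 1) (hz : ‖z‖ ≤ 1) : 1 - conj a * z ≠ 0 := by
  intro h
  have h1 : ‖conj a * z‖ = 1 := by rw [← sub_eq_zero.1 h, norm_one]
  rw [norm_mul, RCLike.norm_conj] at h1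
  nlinarith [norm_nonneg a, norm_nonneg z]

lemma norm_exp_I_mul (θ : ℝ) : ‖Complex.exp (Complex.I * θ)‖ = 1 := by
  rw [mul_comm, Complex.norm_exp_ofReal_mul_I]

lemma differentiableAt_blaschke {m : ℕ} {σ : Fin m → ℂ} (hσ : ∀ j, ‖σ j‖ < 1) {z : ℂ}
    (hz : ‖z‖ ≤ 1) : DifferentiableAt ℂ (blaschke σ) z := by
  unfold blaschke
  refine DifferentiableAt.fun_finsetProd fun j _ => ?_
  exact DifferentiableAt.div (by fun_prop) (by fun_prop) (one_sub_conj_mul_ne_zero (hσ j) hz)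

/-- Cauchy's theorem: the poles lie outside the closed disk, and one factor of `z^(p+1)` is absorbed
into `dz`. -/
lemma integral_blaschke_pow_mul_exp_eq_zero {m : ℕ} {σ : Fin m → ℂ} (hσ : ∀ j, ‖σ j‖ < 1)
    (n p : ℕ) : ∫ θ in (0 : ℝ)..(2 * Real.pi), blaschke σ (Complex.exp (Complex.I * θ)) ^ n *
      Complex.exp (Complex.I * ((p + 1 : ℕ) : ℂ) * θ) = 0 := by
  have h : DiffContOnCl ℂ (fun z => blaschke σ z ^ n * z ^ p) (Metric.ball 0 1) := by
    refine DifferentiableOn.diffContOnCl fun z hz => ?_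
    rw [closure_ball _ one_ne_zero, mem_closedBall_zero_iff] at hz
    exact (((differentiableAt_blaschke hσ hz).pow n).mul
      (differentiableAt_id.pow p)).differentiableWithinAt
  have h0 := h.circleIntegral_eq_zero zero_le_one
  rw [circleIntegral] at h0
  have : ∀ θ : ℝ, deriv (circleMap 0 1) θ • (blaschke σ (circleMap 0 1 θ) ^ n * circleMap 0 1 θ ^ p)
      = Complex.I * (blaschke σ (Complex.exp (Complex.I * θ)) ^ n *
      Complex.exp (Complex.I * ((p + 1 : ℕ) : ℂ) * θ)) := by
    intro θ
    rw [deriv_circleMap, circleMap_zero, Complex.ofReal_one, one_mul, mul_comm (θ : ℂ),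
      show Complex.I * ((p + 1 : ℕ) : ℂ) * θ = ((p + 1 : ℕ) : ℂ) * (Complex.I * θ) by ring,
      Complex.exp_nat_mul, smul_eq_mul]
    ring
  simp_rw [this] at h0
  rw [intervalIntegral.integral_const_mul] at h0
  exact (mul_eq_zero.1 h0).resolve_left Complex.I_ne_zero

lemma norm_circleCoeff_le {f : ℂ → ℂ} (hf : ∀ θ : ℝ, ‖f (Complex.exp (Complex.I * θ))‖ ≤ 1)
    (k : ℕ) : ‖circleCoeff f k‖ ≤ 1 := by
  have hpi := Real.pi_pos
  have := intervalIntegral.norm_integral_le_of_norm_le_const (a := 0) (b := 2 * Real.pi) (C := 1)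
    (f := fun θ : ℝ => f (Complex.exp (Complex.I * θ)) * Complex.exp (-(Complex.I * k * θ)))
    fun θ _ => by
      rw [norm_mul, Complex.norm_exp]
      simpa using hf θ
  rw [sub_zero, abs_of_pos (by positivity), one_mul] at this
  rw [circleCoeff, norm_mul]
  calc _ ≤ ‖(1 / (2 * Real.pi) : ℂ)‖ * (2 * Real.pi) := by gcongr
    _ = 1 := by
      simp [abs_of_pos hpi]
      field_simp

/-- Boundedness of the family matters: the real supremum of an unbounded family is `0` by
convention. -/
lemma norm_circleCoeff_le_coeffSup {f : ℂ → ℂ}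
    (hf : ∀ θ : ℝ, ‖f (Complex.exp (Complex.I * θ))‖ ≤ 1) (k : ℕ) :
    ‖circleCoeff f k‖ ≤ coeffSup f :=
  le_ciSup (f := fun k => ‖circleCoeff f k‖)
    ⟨1, by rintro _ ⟨k, rfl⟩; exact norm_circleCoeff_le hf k⟩ k

section
variable {m : ℕ} {σ : Fin m → ℂ} {ψ : ℝ → ℝ}

lemma IsContinuousArg.pow_mul_exp {B : ℂ → ℂ} (h : IsContinuousArg B ψ) (n : ℕ) (k : ℤ) (θ : ℝ) :
    B (Complex.exp (Complex.I * θ)) ^ n * Complex.exp (-(Complex.I * k * θ)) =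
      osc (fun x => n * ψ x - k * x) θ := by
  rw [h.2, ← Complex.exp_nat_mul, ← Complex.exp_add, osc]
  congr 1
  push_cast
  ring

lemma IsContinuousArg.norm_pow {B : ℂ → ℂ} (h : IsContinuousArg B ψ) (n : ℕ) (θ : ℝ) :
    ‖B (Complex.exp (Complex.I * θ)) ^ n‖ = 1 := by
  rw [h.2, _root_.norm_pow, norm_exp_I_mul, one_pow]

/-- Negative frequencies contribute nothing, so the supremum over `k ≥ 0` controls all integer
frequencies met by the Fejér kernel. -/
lemma norm_integral_le_coeffSup (hσ : ∀ j, ‖σ j‖ < 1) (h : IsContinuousArg (blaschke σ) ψ)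
    (n : ℕ) (k : ℤ) :
    ‖∫ θ in (0 : ℝ)..(2 * Real.pi), blaschke σ (Complex.exp (Complex.I * θ)) ^ n *
      Complex.exp (-(Complex.I * k * θ))‖ ≤ 2 * Real.pi * coeffSup (fun z => blaschke σ z ^ n) := by
  have hle := norm_circleCoeff_le_coeffSup (f := fun z => blaschke σ z ^ n)
    fun θ => (h.norm_pow n θ).le
  have hpi := Real.pi_pos
  rcases lt_or_ge k 0 with hk | hk
  · obtain ⟨p, rfl⟩ : ∃ p : ℕ, k = -((p + 1 : ℕ) : ℤ) := ⟨(-k - 1).toNat, by omega⟩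
    have : ∀ θ : ℝ, -(Complex.I * ((-((p + 1 : ℕ) : ℤ) : ℤ) : ℂ) * θ)
        = Complex.I * ((p + 1 : ℕ) : ℂ) * θ := fun θ => by push_cast; ring
    simp_rw [this]
    rw [integral_blaschke_pow_mul_exp_eq_zero hσ, norm_zero]
    have := (norm_nonneg _).trans (hle 0)
    positivity
  · lift k to ℕ using hk
    have := hle k
    rw [circleCoeff, norm_mul] at this
    have hc : ‖(1 / (2 * Real.pi) : ℂ)‖ = 1 / (2 * Real.pi) := by simp [abs_of_pos hpi]
    rw [hc, div_mul_eq_mul_div, one_mul, div_le_iff₀ (by positivity)] at this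
    rw [mul_comm (2 * Real.pi)]
    exact_mod_cast this

/-- The sup norm of the coefficients of the powers of a Blaschke product decays like `n^(-1/N)`,
if `N - 2` is the maximal order of vanishing of the second derivative of its argument. -/
theorem powersDecay_of_arg (hσ : ∀ j, ‖σ j‖ < 1) (h : IsContinuousArg (blaschke σ) ψ)
    (hψ : ContDiff ℝ ∞ ψ) {N : ℕ} (hN : 2 ≤ N)
    (hord : ∀ θ, ∃ k ≤ N - 2, VanishesToOrder (iteratedDeriv 2 ψ) θ k)
    (hex : ∃ θ, VanishesToOrder (iteratedDeriv 2 ψ) θ (N - 2)) :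
    PowersDecay (blaschke σ) N := by
  have hpi := Real.pi_pos
  have hNpos : (0 : ℝ) < N := by exact_mod_cast (by omega : 0 < N)
  constructor
  · obtain ⟨C, hC, hb⟩ := exists_norm_integral_osc_le hψ hN (fun θ => by
      obtain ⟨k, hk, hv⟩ := hord θ
      refine ⟨k, hk, ?_⟩
      have := hv.2
      rwa [iteratedDeriv_succ, iteratedDeriv_one, ← iteratedDeriv_succ', ← iteratedDeriv_succ']
        at this) (a := 0) (b := 2 * Real.pi) (by positivity)
    refine ⟨1 / (2 * Real.pi) * C, by positivity, fun n hn => ?_⟩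
    refine ciSup_le fun k => ?_
    have heq := fun θ : ℝ => h.pow_mul_exp n k θ
    simp only [Int.cast_natCast] at heq
    rw [circleCoeff, norm_mul]
    simp_rw [heq]
    have hc : ‖(1 / (2 * Real.pi) : ℂ)‖ = 1 / (2 * Real.pi) := by simp [abs_of_pos hpi]
    rw [hc, mul_assoc]
    gcongr
    exact hb n hn k
  · obtain ⟨θ₀, hv⟩ := hex
    obtain ⟨C, hC, hT⟩ := exists_abs_sub_linear_le hψ hN hv.1
    -- Solves `δ + C * δ = 1`: the frequency rounding error (at most `δ`) and the Taylor remainder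
    -- (at most `C * δ`) together stay within one radian.
    set δ : ℝ := 1 / (1 + C)
    have hδ : 0 < δ := by positivity
    have hδ1 : δ ≤ 1 := by
      rw [div_le_one (by positivity)]; linarith
    have hδC : δ + C * δ = 1 := by
      simp only [δ]; field_simp
    set A : ℝ := 4 * (6 * Real.pi ^ 2 + 1)
    have hA : 0 < A := by positivity
    refine ⟨A / δ, by positivity, fun n hn => ?_⟩
    simp only
    have hn1 : (1 : ℝ) ≤ n := by exact_mod_cast hn
    set r : ℝ := (n : ℝ) ^ (-(1 / (N : ℝ)))
    have hr : 0 < r := by positivity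
    have hr1 : r ≤ 1 := Real.rpow_le_one_of_one_le_of_nonpos hn1 (by
      have : 0 < 1 / (N : ℝ) := by positivity
      linarith)
    have hrN : n * r ^ N = 1 := by
      rw [← Real.rpow_natCast, ← Real.rpow_mul (by positivity)]
      have : -(1 / (N : ℝ)) * N = -1 := by field_simp
      rw [this, Real.rpow_neg_one]
      field_simp
    set η := δ * r
    have hη : 0 < η := by positivity
    have hη1 : η ≤ 1 := mul_le_one₀ hδ1 hr.le hr1
    -- The least `M` admitted by `le_norm_integral_mul_fejer`; then `M * η` is also bounded above,
    -- so `1/M` is comparable to `η`.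
    set M := ⌈6 * Real.pi ^ 2 / η⌉₊
    have hMη : 6 * Real.pi ^ 2 ≤ M * η := by
      rw [← div_le_iff₀ hη]; exact Nat.le_ceil _
    have hM : M ≠ 0 := (Nat.ceil_pos.2 (by positivity)).ne'
    have hMpos : (0 : ℝ) < M := by exact_mod_cast Nat.pos_of_ne_zero hM
    have hMle : M * η ≤ 6 * Real.pi ^ 2 + 1 := by
      have := (Nat.ceil_lt_add_one (a := 6 * Real.pi ^ 2 / η) (by positivity)).le
      calc M * η ≤ (6 * Real.pi ^ 2 / η + 1) * η := by gcongr
        _ = 6 * Real.pi ^ 2 + η := by field_simp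
        _ ≤ _ := by linarith
    set k : ℤ := ⌊n * deriv ψ θ₀⌋
    have hk : |n * deriv ψ θ₀ - k| ≤ 1 := by
      rw [abs_le]
      constructor <;> linarith [Int.floor_le (n * deriv ψ θ₀), Int.lt_floor_add_one (n * deriv ψ θ₀)]
    set α : ℝ := n * ψ θ₀ - k * θ₀
    set ρ : ℝ → ℝ := fun s => n * ψ (θ₀ + s) - k * (θ₀ + s) - α with hρdef
    have hρc : Continuous ρ := by
      have := h.1
      fun_prop
    have hρ1 : ∀ s, |s| ≤ η → |ρ s| ≤ 1 := by
      intro s hs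
      have e : ρ s = (n * deriv ψ θ₀ - k) * s + n * (ψ (θ₀ + s) - ψ θ₀ - deriv ψ θ₀ * s) := by
        simp only [hρdef, α]; ring
      have h1 := hT s (hs.trans hη1)
      have h2 : |s| ^ N ≤ δ * r ^ N := by
        calc |s| ^ N ≤ η ^ N := by gcongr
          _ = δ ^ N * r ^ N := mul_pow _ _ _
          _ ≤ δ * r ^ N := by
            gcongr
            exact pow_le_of_le_one hδ.le hδ1 (by omega)
      rw [e]
      refine (abs_add_le _ _).trans ?_
      rw [abs_mul, abs_mul, abs_of_pos (by positivity : (0 : ℝ) < n)]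
      calc |n * deriv ψ θ₀ - k| * |s| + n * |ψ (θ₀ + s) - ψ θ₀ - deriv ψ θ₀ * s|
          ≤ 1 * η + n * (C * (δ * r ^ N)) := by
            gcongr
            exact h1.trans (by gcongr)
        _ = δ * r + C * δ * (n * r ^ N) := by simp only [η]; ring
        _ ≤ δ * 1 + C * δ * 1 := by
            rw [hrN]
            gcongr
        _ = 1 := by rw [mul_one, mul_one, hδC]
    have hlow := le_norm_integral_mul_fejer hρc hη hρ1 hMη
    set F : ℝ → ℂ := fun θ => blaschke σ (Complex.exp (Complex.I * θ)) ^ n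
    have hF : Continuous F := by
      have : F = osc (fun x => n * ψ x) := by
        ext θ
        have := h.pow_mul_exp n 0 θ
        simpa using this
      rw [this]
      exact continuous_osc (by have := h.1; fun_prop)
    have hFper : Function.Periodic F (2 * Real.pi) := by
      intro θ
      simp only [F]
      congr 2
      rw [Complex.exp_eq_exp_iff_exists_int]
      exact ⟨1, by push_cast; ring⟩
    have hup := norm_integral_mul_fejer_le hF hFper (norm_integral_le_coeffSup hσ h n) hM k θ₀
    have heq : ∀ s : ℝ, F (θ₀ + s) * Complex.exp (-(Complex.I * k * (θ₀ + s : ℝ))) * fejer M s =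
        Complex.exp (Complex.I * α) * (osc ρ s * fejer M s) := by
      intro s
      simp only [F]
      rw [h.pow_mul_exp n k, osc, osc, ← mul_assoc, ← Complex.exp_add]
      congr 2
      simp only [hρdef]
      push_cast
      ring
    simp_rw [heq] at hup
    rw [intervalIntegral.integral_const_mul, norm_mul, norm_exp_I_mul, one_mul] at hup
    have hS := hlow.trans hup
    set S := coeffSup fun z => blaschke σ z ^ n
    have hS' : 1 ≤ 4 * M * S := by
      rw [div_le_iff₀ (by positivity)] at hS
      have : Real.pi * 1 ≤ Real.pi * (4 * M * S) := by linarith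
      exact le_of_mul_le_mul_left this hpi
    have hSpos : 0 ≤ S := by
      by_contra! hcon
      nlinarith
    calc r = η / δ * 1 := by simp only [η]; field_simp
      _ ≤ η / δ * (4 * M * S) := by gcongr
      _ = 4 * (M * η) * S / δ := by ring
      _ ≤ 4 * (6 * Real.pi ^ 2 + 1) * S / δ := by gcongr
      _ = A / δ * S := by ring

end

/-! ### Orders of vanishing -/

lemma vanishesToOrder_iff {f : ℝ → ℝ} {x : ℝ} (hf : AnalyticAt ℝ f x) {k : ℕ} :
    VanishesToOrder f x k ↔ analyticOrderAt f x = k :=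
  (analyticOrderAt_eq_nat_iff_iteratedDeriv_eq_zero hf).symm

lemma exists_vanishesToOrder_of_le {f : ℝ → ℝ} {x : ℝ} (hf : AnalyticAt ℝ f x) {K : ℕ}
    (h : analyticOrderAt f x ≤ K) : ∃ k ≤ K, VanishesToOrder f x k := by
  obtain ⟨k, hk⟩ := ENat.ne_top_iff_exists.1 (ne_top_of_le_ne_top (ENat.natCast_ne_top _) h)
  rw [← hk] at h
  exact ⟨k, by exact_mod_cast h, by rw [vanishesToOrder_iff hf, hk]⟩

lemma analyticOrderAt_mul_of_ne_zero {u f : ℝ → ℝ} {x : ℝ} (hu : AnalyticAt ℝ u x)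
    (hf : AnalyticAt ℝ f x) (hne : u x ≠ 0) :
    analyticOrderAt (fun y => u y * f y) x = analyticOrderAt f x := by
  have := analyticOrderAt_mul hu hf
  rw [hu.analyticOrderAt_eq_zero.2 hne, zero_add] at this
  exact this

lemma analyticOrderAt_eq_one {f : ℝ → ℝ} {f' x : ℝ} (hf : AnalyticAt ℝ f x) (h0 : f x = 0)
    (hd : HasDerivAt f f' x) (h1 : f' ≠ 0) : analyticOrderAt f x = 1 :=
  hf.analyticOrderAt_eq_one_of_zero_deriv_ne_zero h0 (by rwa [hd.deriv])

lemma analyticOrderAt_le_one {f : ℝ → ℝ} {f' x : ℝ} (hf : AnalyticAt ℝ f x)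
    (hd : HasDerivAt f f' x) (h : f x ≠ 0 ∨ f' ≠ 0) : analyticOrderAt f x ≤ 1 := by
  by_cases h0 : f x = 0
  · exact (analyticOrderAt_eq_one hf h0 hd (h.resolve_left (by simpa using h0))).le
  · rw [hf.analyticOrderAt_eq_zero.2 h0]; exact zero_le_one

lemma analyticOrderAt_eval_le {P : Polynomial ℝ} (hP : P ≠ 0) (x : ℝ) :
    analyticOrderAt (fun y => P.eval y) x ≤ P.natDegree := by
  obtain ⟨Q, hQ, hnd⟩ := Polynomial.exists_eq_pow_rootMultiplicity_mul_and_not_dvd P hP x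
  have hQx : Q.eval x ≠ 0 := fun h => hnd (Polynomial.dvd_iff_isRoot.2 h)
  have han : ∀ R : Polynomial ℝ, AnalyticAt ℝ (fun y => R.eval y) x := fun R => by
    exact AnalyticOnNhd.eval_polynomial R x (mem_univ x)
  have heq : (fun y => P.eval y) =
      fun y => Q.eval y * (y - x) ^ P.rootMultiplicity x := by
    ext y
    conv_lhs => rw [hQ]
    simp [mul_comm]
  rw [heq, analyticOrderAt_mul_of_ne_zero (han Q) (by fun_prop) hQx]
  have h1 : analyticOrderAt (fun y => (y - x) ^ P.rootMultiplicity x) x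
      = P.rootMultiplicity x := analyticOrderAt_centeredMonomial
  rw [h1]
  have h2 : P.rootMultiplicity x ≤ P.natDegree := by
    rw [← Polynomial.count_roots]
    exact (Multiset.count_le_card _ _).trans P.card_roots'
  exact_mod_cast h2

section
variable {m : ℕ} {σ : Fin m → ℂ} {ψ D E : ℝ → ℝ}

lemma iteratedDeriv_two_eq (hD : ∀ θ, HasDerivAt ψ (D θ) θ) (hE : ∀ θ, HasDerivAt D (E θ) θ) :
    iteratedDeriv 2 ψ = E := by
  have h1 : deriv ψ = D := funext fun θ => (hD θ).deriv
  have h2 : deriv D = E := funext fun θ => (hE θ).deriv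
  rw [iteratedDeriv_succ, iteratedDeriv_one, h1, h2]

lemma contDiff_of_analytic_second_deriv (hD : ∀ θ, HasDerivAt ψ (D θ) θ)
    (hE : ∀ θ, HasDerivAt D (E θ) θ) (han : ∀ θ, AnalyticAt ℝ E θ) : ContDiff ℝ ∞ ψ := by
  have h1 : deriv ψ = D := funext fun θ => (hD θ).deriv
  have h2 : deriv D = E := funext fun θ => (hE θ).deriv
  rw [contDiff_infty_iff_deriv, h1, contDiff_infty_iff_deriv, h2]
  exact ⟨fun θ => (hD θ).differentiableAt, fun θ => (hE θ).differentiableAt,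
    contDiff_iff_contDiffAt.2 fun θ => (han θ).contDiffAt⟩

/-- Decay of the powers, in terms of the orders of vanishing of the analytic function `ψ''`. -/
theorem powersDecay_of_analyticOrderAt (hσ : ∀ j, ‖σ j‖ < 1)
    (h : IsContinuousArg (blaschke σ) ψ) (hD : ∀ θ, HasDerivAt ψ (D θ) θ)
    (hE : ∀ θ, HasDerivAt D (E θ) θ) (han : ∀ θ, AnalyticAt ℝ E θ) {N : ℕ} (hN : 2 ≤ N)
    (hord : ∀ θ, analyticOrderAt E θ ≤ (N - 2 : ℕ))
    (hex : ∃ θ, analyticOrderAt E θ = (N - 2 : ℕ)) :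
    PowersDecay (blaschke σ) N := by
  have e := iteratedDeriv_two_eq hD hE
  refine powersDecay_of_arg hσ h (contDiff_of_analytic_second_deriv hD hE han) hN ?_ ?_
  · intro θ
    rw [e]
    exact exists_vanishesToOrder_of_le (han θ) (hord θ)
  · obtain ⟨θ, hθ⟩ := hex
    exact ⟨θ, by rw [e, vanishesToOrder_iff (han θ), hθ]⟩

/-! ### The argument of a Blaschke product -/

/-- On the circle `z * conj z = 1`, hence `z - σ = z * conj (1 - conj σ * z)` for each factor. -/
lemma blaschke_exp (θ : ℝ) :
    blaschke σ (Complex.exp (Complex.I * θ)) = Complex.exp (Complex.I * θ) ^ m *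
      conj (∏ j, (1 - conj (σ j) * Complex.exp (Complex.I * θ))) /
        ∏ j, (1 - conj (σ j) * Complex.exp (Complex.I * θ)) := by
  rw [map_prod, blaschke, Finset.prod_div_distrib]
  congr 1
  have : Complex.exp (Complex.I * θ) ^ m = ∏ _j : Fin m, Complex.exp (Complex.I * θ) := by simp
  rw [this, ← Finset.prod_mul_distrib]
  refine Finset.prod_congr rfl fun j _ => ?_
  have hz : Complex.exp (Complex.I * θ) * conj (Complex.exp (Complex.I * θ)) = 1 := by
    rw [Complex.mul_conj', norm_exp_I_mul]; simp
  simp only [map_sub, map_one, map_mul, Complex.conj_conj]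
  linear_combination (σ j) * hz

/-- A continuous logarithm of `∏ (1 - conj (σ j) z)` on the circle gives a continuous argument. -/
lemma isContinuousArg_of_exp {l : ℝ → ℂ} (hl : Continuous l)
    (h : ∀ θ : ℝ, Complex.exp (l θ) = ∏ j, (1 - conj (σ j) * Complex.exp (Complex.I * θ))) :
    IsContinuousArg (blaschke σ) (fun θ => m * θ - 2 * (l θ).im) := by
  refine ⟨by fun_prop, fun θ => ?_⟩
  rw [blaschke_exp, ← h, ← Complex.exp_conj, ← Complex.exp_nat_mul, ← Complex.exp_add,
    ← Complex.exp_sub]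
  congr 1
  apply Complex.ext <;> simp
  ring

lemma one_sub_mem_slitPlane {w : ℂ} (hw : ‖w‖ < 1) : 1 - w ∈ Complex.slitPlane := by
  refine Complex.mem_slitPlane_iff.2 (Or.inl ?_)
  have := Complex.re_le_norm w
  simp
  linarith

/-- The Poisson kernel. -/
noncomputable def poisson (a : ℂ) (θ : ℝ) : ℝ :=
  (1 - Complex.normSq a) / Complex.normSq (1 - conj a * Complex.exp (Complex.I * θ))

lemma hasDerivAt_exp_I_mul (θ : ℝ) : HasDerivAt (fun θ : ℝ => Complex.exp (Complex.I * θ))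
    (Complex.I * Complex.exp (Complex.I * θ)) θ := by
  have := (((hasDerivAt_id θ).ofReal_comp).const_mul Complex.I).cexp
  refine this.congr_deriv ?_
  simp
  ring

lemma normSq_exp_I_mul (θ : ℝ) : Complex.normSq (Complex.exp (Complex.I * θ)) = 1 := by
  rw [Complex.normSq_eq_norm_sq, norm_exp_I_mul, one_pow]

/-- Each `1 - conj (σ j) z` stays in the right half-plane, so the principal logarithm is smooth
along the circle. With `b = conj (σ j) z` the `j`-th term of the derivative is `Re((1+b)/(1-b))`,
the Poisson kernel. -/
theorem exists_isContinuousArg (hσ : ∀ j, ‖σ j‖ < 1) :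
    ∃ ψ : ℝ → ℝ, IsContinuousArg (blaschke σ) ψ ∧
      ∀ θ, HasDerivAt ψ (∑ j, poisson (σ j) θ) θ := by
  have hlt : ∀ j (θ : ℝ), ‖conj (σ j) * Complex.exp (Complex.I * θ)‖ < 1 := fun j θ => by
    rw [norm_mul, norm_exp_I_mul, mul_one, RCLike.norm_conj]; exact hσ j
  set l : ℝ → ℂ := fun θ => ∑ j, Complex.log (1 - conj (σ j) * Complex.exp (Complex.I * θ))
  set l' : ℝ → ℂ := fun θ => ∑ j, -(conj (σ j) * (Complex.I * Complex.exp (Complex.I * θ))) /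
    (1 - conj (σ j) * Complex.exp (Complex.I * θ))
  have hl : ∀ θ, HasDerivAt l (l' θ) θ := fun θ => by
    refine HasDerivAt.fun_sum fun j _ => ?_
    have := ((hasDerivAt_exp_I_mul θ).const_mul (conj (σ j))).const_sub 1
    exact this.clog_real (one_sub_mem_slitPlane (hlt j θ))
  refine ⟨_, isContinuousArg_of_exp (l := l)
    (continuous_iff_continuousAt.2 fun θ => (hl θ).continuousAt) fun θ => ?_, fun θ => ?_⟩
  · rw [Complex.exp_sum]
    exact Finset.prod_congr rfl fun j _ =>
      Complex.exp_log (Complex.slitPlane_ne_zero (one_sub_mem_slitPlane (hlt j θ)))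
  · have him : HasDerivAt (fun θ => (l θ).im) (l' θ).im θ :=
      Complex.imCLM.hasFDerivAt.comp_hasDerivAt θ (hl θ)
    have := ((hasDerivAt_id θ).const_mul (m : ℝ)).sub (him.const_mul 2)
    refine this.congr_deriv ?_
    have hm : (m : ℝ) * 1 = ∑ _j : Fin m, (1 : ℝ) := by simp
    rw [hm, Complex.im_sum, Finset.mul_sum, ← Finset.sum_sub_distrib]
    refine Finset.sum_congr rfl fun j _ => ?_
    have hne : 1 - conj (σ j) * Complex.exp (Complex.I * θ) ≠ 0 :=
      Complex.slitPlane_ne_zero (one_sub_mem_slitPlane (hlt j θ))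
    have hns : Complex.normSq (conj (σ j) * Complex.exp (Complex.I * θ)) = Complex.normSq (σ j) := by
      rw [Complex.normSq_mul, normSq_exp_I_mul, Complex.normSq_conj, mul_one]
    rw [poisson, ← hns, ← mul_assoc, mul_comm (conj (σ j)), mul_assoc]
    set b := conj (σ j) * Complex.exp (Complex.I * θ)
    have hn : Complex.normSq (1 - b) ≠ 0 := by simpa using hne
    rw [Complex.div_im]
    simp only [Complex.normSq_apply] at hn ⊢
    simp only [Complex.sub_re, Complex.sub_im, Complex.one_re, Complex.one_im, Complex.neg_re,
      Complex.neg_im, Complex.mul_re, Complex.mul_im, Complex.I_re, Complex.I_im] at hn ⊢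
    have hn' : (1 - b.re) ^ 2 + (0 - b.im) ^ 2 ≠ 0 := by
      intro h0; apply hn; linear_combination h0
    field_simp
    ring

end

/-! ### Degree one -/

lemma normSq_one_sub_conj_mul_exp (a : ℂ) (θ : ℝ) :
    Complex.normSq (1 - conj a * Complex.exp (Complex.I * θ)) =
      1 + Complex.normSq a - 2 * (a.re * Real.cos θ + a.im * Real.sin θ) := by
  have h1 : (Complex.exp (Complex.I * θ)).re = Real.cos θ := by
    rw [mul_comm, Complex.exp_ofReal_mul_I_re]
  have h2 : (Complex.exp (Complex.I * θ)).im = Real.sin θ := by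
    rw [mul_comm, Complex.exp_ofReal_mul_I_im]
  simp only [Complex.normSq_apply, Complex.sub_re, Complex.sub_im, Complex.mul_re, Complex.mul_im,
    Complex.conj_re, Complex.conj_im, Complex.one_re, Complex.one_im, h1, h2]
  linear_combination (a.re ^ 2 + a.im ^ 2) * Real.sin_sq_add_cos_sq θ

/-- `ψ''` is a nonvanishing factor `u` times `l θ = |a| sin(θ - arg a)`, which has only simple
zeros, one of them at `arg a`. -/
theorem powersDecay_degree_one {a : ℂ} (ha : ‖a‖ < 1) (ha0 : a ≠ 0) :
    PowersDecay (blaschke (fun _ : Fin 1 => a)) 3 := by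
  have hσ : ∀ j : Fin 1, ‖(fun _ : Fin 1 => a) j‖ < 1 := fun _ => ha
  obtain ⟨ψ, hψ, hD⟩ := exists_isContinuousArg hσ
  simp only [Finset.univ_unique, Finset.sum_const, Finset.card_singleton, one_smul] at hD
  have hc : 1 - Complex.normSq a ≠ 0 := by
    rw [Complex.normSq_eq_norm_sq]; nlinarith [norm_nonneg a]
  set q : ℝ → ℝ := fun θ => 1 + Complex.normSq a - 2 * (a.re * Real.cos θ + a.im * Real.sin θ)
  have hq : ∀ θ, q θ ≠ 0 := fun θ => by
    simp only [q]
    rw [← normSq_one_sub_conj_mul_exp]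
    simpa using one_sub_conj_mul_ne_zero ha (norm_exp_I_mul θ).le
  set l : ℝ → ℝ := fun θ => a.re * Real.sin θ - a.im * Real.cos θ
  have hpo : poisson a = fun θ => (1 - Complex.normSq a) / q θ := by
    ext θ; rw [poisson, normSq_one_sub_conj_mul_exp]
  rw [hpo] at hD
  set u : ℝ → ℝ := fun θ => -2 * (1 - Complex.normSq a) / q θ ^ 2
  have hqd : ∀ θ, HasDerivAt q (2 * l θ) θ := fun θ => by
    have := ((((Real.hasDerivAt_cos θ).const_mul a.re).add
      ((Real.hasDerivAt_sin θ).const_mul a.im)).const_mul 2).const_sub (1 + Complex.normSq a)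
    refine this.congr_deriv ?_
    simp only [l]; ring
  have hE : ∀ θ, HasDerivAt (fun θ => (1 - Complex.normSq a) / q θ) (u θ * l θ) θ := fun θ => by
    refine ((hasDerivAt_const θ (1 - Complex.normSq a)).div (hqd θ) (hq θ)).congr_deriv ?_
    simp only [u]; ring
  have hqa : ∀ θ, AnalyticAt ℝ q θ := fun θ => by fun_prop
  have hla : ∀ θ, AnalyticAt ℝ l θ := fun θ => by fun_prop
  have hua : ∀ θ, AnalyticAt ℝ u θ := fun θ =>
    analyticAt_const.div ((hqa θ).pow 2) (pow_ne_zero 2 (hq θ))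
  have hu0 : ∀ θ, u θ ≠ 0 := fun θ =>
    div_ne_zero (mul_ne_zero (by norm_num) hc) (pow_ne_zero 2 (hq θ))
  have hld : ∀ θ, HasDerivAt l (a.re * Real.cos θ + a.im * Real.sin θ) θ := fun θ => by
    refine (((Real.hasDerivAt_sin θ).const_mul a.re).sub
      ((Real.hasDerivAt_cos θ).const_mul a.im)).congr_deriv ?_
    ring
  have hl0 : ∀ θ, l θ ≠ 0 ∨ a.re * Real.cos θ + a.im * Real.sin θ ≠ 0 := fun θ => by
    by_contra! hcon
    apply ha0
    rw [← Complex.normSq_eq_zero, Complex.normSq_apply]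
    have h1 : a.re * Real.sin θ - a.im * Real.cos θ = 0 := hcon.1
    linear_combination (-(a.re ^ 2 + a.im ^ 2)) * Real.sin_sq_add_cos_sq θ
      + (a.re * Real.sin θ - a.im * Real.cos θ) * h1
      + (a.re * Real.cos θ + a.im * Real.sin θ) * hcon.2
  refine powersDecay_of_analyticOrderAt hσ hψ hD hE (fun θ => (hua θ).mul (hla θ)) (by norm_num)
    (fun θ => ?_) ⟨a.arg, ?_⟩
  · rw [analyticOrderAt_mul_of_ne_zero (hua θ) (hla θ) (hu0 θ)]
    exact analyticOrderAt_le_one (hla θ) (hld θ) (hl0 θ)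
  · rw [analyticOrderAt_mul_of_ne_zero (hua _) (hla _) (hu0 _)]
    have hz : l a.arg = 0 := by
      have h1 := Complex.norm_mul_cos_arg a
      have h2 := Complex.norm_mul_sin_arg a
      simp only [l]
      linear_combination (-Real.sin a.arg) * h1 + Real.cos a.arg * h2
    exact analyticOrderAt_eq_one (hla _) hz (hld _) ((hl0 _).resolve_left (by simpa using hz))

/-! ### Products whose argument has an even derivative -/

lemma hasDerivAt_sin_half (θ : ℝ) :
    HasDerivAt (fun θ => Real.sin (θ / 2)) (Real.cos (θ / 2) / 2) θ := by
  refine (((hasDerivAt_id θ).div_const 2).sin).congr_deriv ?_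
  simp only [id]; ring

lemma hasDerivAt_cos_half (θ : ℝ) :
    HasDerivAt (fun θ => Real.cos (θ / 2)) (-Real.sin (θ / 2) / 2) θ := by
  refine (((hasDerivAt_id θ).div_const 2).cos).congr_deriv ?_
  simp only [id]; ring

lemma hasDerivAt_sin_half_sq (θ : ℝ) : HasDerivAt (fun θ => Real.sin (θ / 2) ^ 2)
    (Real.sin (θ / 2) * Real.cos (θ / 2)) θ := by
  refine ((hasDerivAt_sin_half θ).pow 2).congr_deriv ?_
  simp; ring

lemma sin_half_sq_mem_Icc (θ : ℝ) : Real.sin (θ / 2) ^ 2 ∈ Icc (0 : ℝ) 1 :=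
  ⟨sq_nonneg _, Real.sin_sq_le_one _⟩

/-- Decay of the powers if `ψ'` is a function `g` of `sin² (θ/2)` with `g' x = x ^ r * R x`. -/
theorem powersDecay_of_even {m : ℕ} {σ : Fin m → ℂ} (hσ : ∀ j, ‖σ j‖ < 1) {g R : ℝ → ℝ} {r : ℕ}
    (hg : ∀ θ, ∑ j, poisson (σ j) θ = g (Real.sin (θ / 2) ^ 2))
    (hgd : ∀ x ∈ Icc (0 : ℝ) 1, HasDerivAt g (x ^ r * R x) x)
    (hR : ∀ x ∈ Icc (0 : ℝ) 1, AnalyticAt ℝ R x) (h0 : R 0 ≠ 0) (h1 : R 1 ≠ 0)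
    (hord : ∀ x ∈ Ioo (0 : ℝ) 1, analyticOrderAt R x ≤ (2 * r + 1 : ℕ)) :
    PowersDecay (blaschke σ) (2 * r + 3) := by
  obtain ⟨ψ, hψ, hD⟩ := exists_isContinuousArg hσ
  simp_rw [hg] at hD
  set s : ℝ → ℝ := fun θ => Real.sin (θ / 2)
  set c : ℝ → ℝ := fun θ => Real.cos (θ / 2)
  have hsa : ∀ θ, AnalyticAt ℝ s θ := fun θ => by fun_prop
  have hca : ∀ θ, AnalyticAt ℝ c θ := fun θ => by fun_prop
  have hRa : ∀ θ, AnalyticAt ℝ (fun θ => R (s θ ^ 2)) θ := fun θ =>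
    (hR _ (sin_half_sq_mem_Icc θ)).fun_comp (f := fun θ => s θ ^ 2) ((hsa θ).fun_pow 2)
  have hsc : ∀ θ, s θ ^ 2 + c θ ^ 2 = 1 := fun θ => Real.sin_sq_add_cos_sq _
  -- The chain rule contributes `sin(θ/2) cos(θ/2)`: besides `x ^ r = s ^ (2r)` there is one more
  -- `s`, and a factor `c` with a simple zero at `θ = π`.
  set E : ℝ → ℝ := fun θ => s θ ^ (2 * r + 1) * c θ * R (s θ ^ 2)
  have hE : ∀ θ, HasDerivAt (fun θ => g (s θ ^ 2)) (E θ) θ := fun θ => by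
    refine ((hgd _ (sin_half_sq_mem_Icc θ)).comp θ (hasDerivAt_sin_half_sq θ)).congr_deriv ?_
    simp only [E, s, c]
    rw [← pow_mul, pow_succ]
    ring
  have hzero : ∀ θ, s θ = 0 → analyticOrderAt E θ = (2 * r + 1 : ℕ) := fun θ hs => by
    have hc : c θ ≠ 0 := fun hc => by simpa [hs, hc] using hsc θ
    have : E = fun θ => (c θ * R (s θ ^ 2)) * s θ ^ (2 * r + 1) := by
      ext θ; simp only [E]; ring
    rw [this, analyticOrderAt_mul_of_ne_zero ((hca θ).fun_mul (hRa θ)) ((hsa θ).fun_pow _)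
      (mul_ne_zero hc (by simpa [hs] using h0))]
    change analyticOrderAt (s ^ (2 * r + 1)) θ = _
    rw [analyticOrderAt_pow (hsa θ),
      analyticOrderAt_eq_one (hsa θ) hs (hasDerivAt_sin_half θ) (by simpa [c] using hc)]
    simp
  refine powersDecay_of_analyticOrderAt hσ hψ hD hE
    (fun θ => (((hsa θ).pow _).mul (hca θ)).mul (hRa θ)) (by omega) (fun θ => ?_)
    ⟨0, hzero 0 (by simp [s])⟩
  rw [show 2 * r + 3 - 2 = 2 * r + 1 by omega]
  by_cases hs : s θ = 0
  · exact (hzero θ hs).le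
  by_cases hc : c θ = 0
  · have : E = fun θ => (s θ ^ (2 * r + 1) * R (s θ ^ 2)) * c θ := by
      ext θ; simp only [E]; ring
    have hs1 : s θ ^ 2 = 1 := by simpa [hc] using hsc θ
    rw [this, analyticOrderAt_mul_of_ne_zero (((hsa θ).fun_pow _).fun_mul (hRa θ)) (hca θ)
      (mul_ne_zero (pow_ne_zero _ hs) (by simpa [hs1] using h1)),
      analyticOrderAt_eq_one (hca θ) hc (hasDerivAt_cos_half θ) (by simpa [s] using hs)]
    exact_mod_cast (by omega : 1 ≤ 2 * r + 1)
  · rw [analyticOrderAt_mul_of_ne_zero (((hsa θ).fun_pow _).fun_mul (hca θ)) (hRa θ)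
      (mul_ne_zero (pow_ne_zero _ hs) hc)]
    -- Away from multiples of `π`, `θ ↦ sin²(θ/2)` is a local diffeomorphism and preserves orders.
    have hcomp := analyticOrderAt_comp_of_deriv_ne_zero (f := R) ((hsa θ).pow 2)
      (by
        have : HasDerivAt (s ^ 2) (s θ * c θ) θ := hasDerivAt_sin_half_sq θ
        rw [this.deriv]
        exact mul_ne_zero hs hc)
    have e : (fun θ => R (s θ ^ 2)) = R ∘ (s ^ 2) := rfl
    rw [e, hcomp]
    refine hord _ ⟨?_, ?_⟩
    · simp only [Pi.pow_apply]; positivity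
    · have : 0 < c θ ^ 2 := by positivity
      simp only [Pi.pow_apply]
      linarith [hsc θ]

/-! ### Zeros given by the Cayley transform -/

lemma isZeroTuple_cayleyZeros {m : ℕ} {w : Fin m → ℂ} (hw : ∀ j, 0 < (w j).re) (h1 : ∀ j, w j ≠ 1) :
    IsZeroTuple (cayleyZeros w) := by
  intro j
  have hne : w j + 1 ≠ 0 := fun h => by
    have := congrArg Complex.re h
    simp at this
    linarith [hw j]
  refine ⟨?_, div_ne_zero (sub_ne_zero.2 (h1 j)) hne⟩
  rw [cayleyZeros, norm_div, div_lt_one (norm_pos_iff.2 hne),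
    ← sq_lt_sq₀ (norm_nonneg _) (norm_nonneg _), ← Complex.normSq_eq_norm_sq,
    ← Complex.normSq_eq_norm_sq, Complex.normSq_apply, Complex.normSq_apply]
  simp
  nlinarith [hw j]

lemma poisson_cayley {w : ℂ} (hw : 0 < w.re) (θ : ℝ) : poisson ((w - 1) / (w + 1)) θ =
    w.re / (1 + (w.re ^ 2 + w.im ^ 2 - 1) * Real.sin (θ / 2) ^ 2 - w.im * Real.sin θ) := by
  have hn : Complex.normSq (w + 1) = (w.re + 1) ^ 2 + w.im ^ 2 := by
    rw [Complex.normSq_apply]; simp; ring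
  have hn0 : 0 < (w.re + 1) ^ 2 + w.im ^ 2 := by positivity
  have hre : ((w - 1) / (w + 1)).re = (w.re ^ 2 + w.im ^ 2 - 1) / ((w.re + 1) ^ 2 + w.im ^ 2) := by
    rw [Complex.div_re, hn]; simp; field_simp; ring
  have him : ((w - 1) / (w + 1)).im = 2 * w.im / ((w.re + 1) ^ 2 + w.im ^ 2) := by
    rw [Complex.div_im, hn]; simp; field_simp; ring
  have hsq : Complex.normSq ((w - 1) / (w + 1)) =
      ((w.re - 1) ^ 2 + w.im ^ 2) / ((w.re + 1) ^ 2 + w.im ^ 2) := by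
    rw [map_div₀, hn, Complex.normSq_apply]; simp; ring
  have hcos : Real.cos θ = 1 - 2 * Real.sin (θ / 2) ^ 2 := by
    have := Real.cos_two_mul' (θ / 2)
    rw [mul_div_cancel₀ θ two_ne_zero] at this
    linarith [Real.sin_sq_add_cos_sq (θ / 2)]
  rw [poisson, normSq_one_sub_conj_mul_exp, hre, him, hsq, hcos]
  set S := Real.sin (θ / 2) ^ 2
  set n := (w.re + 1) ^ 2 + w.im ^ 2 with hndef
  have e1 : 1 - ((w.re - 1) ^ 2 + w.im ^ 2) / n = (4 / n) * w.re := by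
    field_simp; rw [hndef]; ring
  have e2 : 1 + ((w.re - 1) ^ 2 + w.im ^ 2) / n - 2 * ((w.re ^ 2 + w.im ^ 2 - 1) / n * (1 - 2 * S) +
      2 * w.im / n * Real.sin θ) =
      (4 / n) * (1 + (w.re ^ 2 + w.im ^ 2 - 1) * S - w.im * Real.sin θ) := by
    field_simp; rw [hndef]; ring
  rw [e1, e2, mul_div_mul_left _ _ (by positivity)]

/-- The denominator for a pair of conjugate points, where `e = |w|² - 1`, `f = 4 (Im w)²`. -/
def pairDen (e f x : ℝ) : ℝ := 1 + (2 * e - f) * x + (e ^ 2 + f) * x ^ 2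

/-- The numerator of the derivative for a pair of conjugate points. -/
def pairNum (e f x : ℝ) : ℝ := f - e - 2 * (e ^ 2 + f) * x - e * (e ^ 2 + f) * x ^ 2

/-- A sum of a square and a multiple of `x(1-x)`: the latter is positive inside the interval, the
former at both ends. -/
lemma pairDen_pos {p q x : ℝ} (hp : 0 < p) (hx : x ∈ Icc (0 : ℝ) 1) :
    0 < pairDen (p ^ 2 + q ^ 2 - 1) (4 * q ^ 2) x := by
  have e : pairDen (p ^ 2 + q ^ 2 - 1) (4 * q ^ 2) x =
      (1 - x - (p ^ 2 + q ^ 2) * x) ^ 2 + 4 * p ^ 2 * (x * (1 - x)) := by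
    unfold pairDen; ring
  rw [e]
  have hx0 := hx.1
  have hx1 : 0 ≤ 1 - x := by linarith [hx.2]
  have h2 : 0 ≤ 4 * p ^ 2 * (x * (1 - x)) := by positivity
  rcases hx0.eq_or_lt with h | h
  · rw [← h]; norm_num
  rcases hx1.eq_or_lt with h' | h'
  · have : 0 < (1 - x - (p ^ 2 + q ^ 2) * x) ^ 2 := by
      rw [← h', zero_sub, neg_sq]; positivity
    linarith
  · positivity

lemma hasDerivAt_pair (p e f : ℝ) {x : ℝ} (h : pairDen e f x ≠ 0) :
    HasDerivAt (fun x => 2 * p * (1 + e * x) / pairDen e f x)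
      (2 * p * pairNum e f x / pairDen e f x ^ 2) x := by
  have h1 : HasDerivAt (fun x => 2 * p * (1 + e * x)) (2 * p * e) x := by
    refine ((((hasDerivAt_id x).const_mul e).const_add 1).const_mul (2 * p)).congr_deriv ?_
    ring
  have h2 : HasDerivAt (pairDen e f) ((2 * e - f) + (e ^ 2 + f) * (2 * x)) x := by
    refine ((((hasDerivAt_id x).const_mul (2 * e - f)).const_add 1).add
      ((hasDerivAt_pow 2 x).const_mul (e ^ 2 + f))).congr_deriv ?_
    simp
  refine (h1.div h2 h).congr_deriv ?_
  congr 1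
  unfold pairNum pairDen
  ring

lemma analyticAt_pairDen (e f x : ℝ) : AnalyticAt ℝ (pairDen e f) x := by
  unfold pairDen; fun_prop

/-- The conjugate denominators differ only in the sign of the `sin θ` term, so over a common
denominator only `sin² θ = 4S(1-S)` survives, with `S = sin²(θ/2)`. -/
lemma poisson_cayley_pair {w : ℂ} (hw : 0 < w.re) (θ : ℝ) :
    poisson ((w - 1) / (w + 1)) θ + poisson ((conj w - 1) / (conj w + 1)) θ =
      2 * w.re * (1 + (w.re ^ 2 + w.im ^ 2 - 1) * Real.sin (θ / 2) ^ 2) /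
        pairDen (w.re ^ 2 + w.im ^ 2 - 1) (4 * w.im ^ 2) (Real.sin (θ / 2) ^ 2) := by
  rw [poisson_cayley hw, poisson_cayley (by simpa using hw)]
  simp only [Complex.conj_re, Complex.conj_im, neg_sq]
  have hpos := pairDen_pos (q := w.im) hw (sin_half_sq_mem_Icc θ)
  have hsin : Real.sin θ = 2 * Real.sin (θ / 2) * Real.cos (θ / 2) := by
    rw [← Real.sin_two_mul, mul_div_cancel₀ θ two_ne_zero]
  have hsc := Real.sin_sq_add_cos_sq (θ / 2)
  set S := Real.sin (θ / 2) ^ 2 with hS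
  set A := 1 + (w.re ^ 2 + w.im ^ 2 - 1) * S with hA
  have hprod : pairDen (w.re ^ 2 + w.im ^ 2 - 1) (4 * w.im ^ 2) S =
      (A - w.im * Real.sin θ) * (A - -w.im * Real.sin θ) := by
    have : Real.sin θ ^ 2 = 4 * S * (1 - S) := by
      rw [hsin, hS]; linear_combination 4 * Real.sin (θ / 2) ^ 2 * hsc
    unfold pairDen
    rw [hA]
    linear_combination w.im ^ 2 * this
  rw [hprod] at hpos ⊢
  have h1 : A - w.im * Real.sin θ ≠ 0 := left_ne_zero_of_mul hpos.ne'
  have h2 : A - -w.im * Real.sin θ ≠ 0 := right_ne_zero_of_mul hpos.ne'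
  rw [neg_mul, sub_neg_eq_add] at *
  field_simp
  ring

lemma re_pow_three (w : ℂ) : (w ^ 3).re = w.re ^ 3 - 3 * w.re * w.im ^ 2 := by
  simp [pow_succ]; ring

lemma re_pow_five (w : ℂ) :
    (w ^ 5).re = w.re ^ 5 - 10 * w.re ^ 3 * w.im ^ 2 + 5 * w.re * w.im ^ 4 := by
  simp [pow_succ]; ring

lemma re_pow_seven (w : ℂ) : (w ^ 7).re =
    w.re ^ 7 - 21 * w.re ^ 5 * w.im ^ 2 + 35 * w.re ^ 3 * w.im ^ 4 - 7 * w.re * w.im ^ 6 := by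
  simp [pow_succ]; ring

lemma re_zpow_neg_one (w : ℂ) : (w ^ (-1 : ℤ)).re = w.re / (w.re ^ 2 + w.im ^ 2) := by
  rw [zpow_neg_one, Complex.inv_re, Complex.normSq_apply, pow_two, pow_two]

lemma re_zpow_neg_three (w : ℂ) : (w ^ (-3 : ℤ)).re =
    (w.re ^ 3 - 3 * w.re * w.im ^ 2) / (w.re ^ 2 + w.im ^ 2) ^ 3 := by
  rw [zpow_neg, show (3 : ℤ) = ((3 : ℕ) : ℤ) by norm_num, zpow_natCast, Complex.inv_re,
    re_pow_three, map_pow, Complex.normSq_apply, pow_two w.re, pow_two w.im]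

/-- The equation `h3` amounts to `f = e`, which removes the constant term of `pairNum` and leaves
`-(e²+e) x (2+ex)`. Here `e > 0`, so the cofactor of `x` has no zero on `[0, 1]`. -/
theorem powersDecay_conj_pair {w : ℂ} (h1 : w ≠ 1) (hw : 0 < w.re) (h3 : w.re = (w ^ 3).re) :
    IsZeroTuple (cayleyZeros ![w, conj w]) ∧
      PowersDecay (blaschke (cayleyZeros ![w, conj w])) 5 := by
  have hz : IsZeroTuple (cayleyZeros ![w, conj w]) := by
    refine isZeroTuple_cayleyZeros ?_ ?_
    · simp [Fin.forall_fin_two, hw]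
    · simp only [Fin.forall_fin_two, Matrix.cons_val_zero, Matrix.cons_val_one]
      refine ⟨h1, fun h => h1 ?_⟩
      simpa using congrArg conj h
  refine ⟨hz, ?_⟩
  rw [re_pow_three] at h3
  set p := w.re with hp
  set q := w.im with hq
  have hfe : 4 * q ^ 2 = p ^ 2 + q ^ 2 - 1 := by
    have : p * (4 * q ^ 2) = p * (p ^ 2 + q ^ 2 - 1) := by linear_combination h3
    exact mul_left_cancel₀ hw.ne' this
  have hq0 : 0 < q ^ 2 := by
    refine (sq_nonneg q).lt_of_ne' fun h0 => h1 ?_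
    have h2 : p = 1 := by nlinarith
    exact Complex.ext h2 (by simpa using h0)
  have he : 0 < p ^ 2 + q ^ 2 - 1 := by linarith
  have hpos : ∀ x ∈ Icc (0 : ℝ) 1, pairDen (p ^ 2 + q ^ 2 - 1) (4 * q ^ 2) x ≠ 0 := fun x hx =>
    (pairDen_pos hw hx).ne'
  set e := p ^ 2 + q ^ 2 - 1
  rw [hfe] at hpos
  have hR0 : ∀ x ∈ Icc (0 : ℝ) 1,
      -2 * p * (e ^ 2 + e) * (2 + e * x) / pairDen e e x ^ 2 ≠ 0 := fun x hx => by
    have hx0 := hx.1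
    refine div_ne_zero (mul_ne_zero (mul_ne_zero (mul_ne_zero (by norm_num) hw.ne')
      (by positivity)) (by positivity)) (pow_ne_zero 2 (hpos x hx))
  have hRa : ∀ x ∈ Icc (0 : ℝ) 1, AnalyticAt ℝ
      (fun x => -2 * p * (e ^ 2 + e) * (2 + e * x) / pairDen e e x ^ 2) x := fun x hx =>
    AnalyticAt.div (by fun_prop) ((analyticAt_pairDen e e x).pow 2) (pow_ne_zero 2 (hpos x hx))
  refine powersDecay_of_even (r := 1) (fun j => (hz j).1)
    (g := fun x => 2 * p * (1 + e * x) / pairDen e e x)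
    (R := fun x => -2 * p * (e ^ 2 + e) * (2 + e * x) / pairDen e e x ^ 2) (fun θ => ?_)
    (fun x hx => ?_) hRa (hR0 0 (by simp)) (hR0 1 (by simp)) (fun x hx => ?_)
  · have := poisson_cayley_pair hw θ
    rw [← hp, ← hq, hfe] at this
    simpa [cayleyZeros, Fin.sum_univ_two] using this
  · refine (hasDerivAt_pair p e e (hpos x hx)).congr_deriv ?_
    unfold pairNum
    ring
  · have hx' := Ioo_subset_Icc_self hx
    rw [(hRa x hx').analyticOrderAt_eq_zero.2 (hR0 x hx')]
    exact zero_le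

/-- With `b_j = 1 + (w_j²-1)x` and `K = w₁(w₁²-1) = -w₂(w₂²-1)` the derivative is
`-K(b₂-b₁)(b₂+b₁)/(b₁b₂)²`; here `b₂ - b₁` is a nonzero multiple of `x` and `b₁ + b₂ > 0`. -/
theorem powersDecay_real_pair {w₁ w₂ : ℝ} (hw₁ : 0 < w₁) (h₁ : w₁ ≠ 1) (hw₂ : 0 < w₂) (h₂ : w₂ ≠ 1)
    (h3 : w₁ + w₂ = w₁ ^ 3 + w₂ ^ 3) :
    IsZeroTuple (cayleyZeros ![(w₁ : ℂ), (w₂ : ℂ)]) ∧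
      PowersDecay (blaschke (cayleyZeros ![(w₁ : ℂ), (w₂ : ℂ)])) 5 := by
  have hz : IsZeroTuple (cayleyZeros ![(w₁ : ℂ), (w₂ : ℂ)]) := by
    refine isZeroTuple_cayleyZeros ?_ ?_
    · simp [Fin.forall_fin_two, hw₁, hw₂]
    · simp [Fin.forall_fin_two, h₁, h₂]
  refine ⟨hz, ?_⟩
  have hden : ∀ w : ℝ, 0 < w → ∀ x ∈ Icc (0 : ℝ) 1, 0 < 1 + (w ^ 2 - 1) * x := fun w hw x hx => by
    have h1 : 0 ≤ 1 - x := by linarith [hx.2]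
    have h2 := hx.1
    have : 1 + (w ^ 2 - 1) * x = (1 - x) + w ^ 2 * x := by ring
    rw [this]
    rcases h2.eq_or_lt with h | h
    · rw [← h]; norm_num
    · positivity
  have he₁ : w₁ ^ 2 - 1 ≠ 0 := by
    intro h
    have : (w₁ - 1) * (w₁ + 1) = 0 := by linear_combination h
    rcases mul_eq_zero.1 this with h' | h'
    · exact h₁ (by linarith)
    · linarith
  have he : w₂ ^ 2 - w₁ ^ 2 ≠ 0 := by
    intro h
    have hw : w₁ * (w₁ ^ 2 - 1) + w₂ * (w₁ ^ 2 - 1) = 0 := by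
      linear_combination -h3 - w₂ * h
    have : (w₁ + w₂) * (w₁ ^ 2 - 1) = 0 := by linear_combination hw
    exact mul_ne_zero (by positivity) he₁ this
  have hR0 : ∀ x ∈ Icc (0 : ℝ) 1, -(w₁ * (w₁ ^ 2 - 1) * (w₂ ^ 2 - w₁ ^ 2)) *
      (2 + (w₁ ^ 2 - 1 + (w₂ ^ 2 - 1)) * x) /
        ((1 + (w₁ ^ 2 - 1) * x) * (1 + (w₂ ^ 2 - 1) * x)) ^ 2 ≠ 0 := fun x hx => by
    have d1 := hden w₁ hw₁ x hx
    have d2 := hden w₂ hw₂ x hx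
    refine div_ne_zero (mul_ne_zero (neg_ne_zero.2 (mul_ne_zero (mul_ne_zero hw₁.ne' he₁) he)) ?_)
      (by positivity)
    intro h
    linarith
  have hRa : ∀ x ∈ Icc (0 : ℝ) 1, AnalyticAt ℝ (fun x => -(w₁ * (w₁ ^ 2 - 1) * (w₂ ^ 2 - w₁ ^ 2)) *
      (2 + (w₁ ^ 2 - 1 + (w₂ ^ 2 - 1)) * x) /
        ((1 + (w₁ ^ 2 - 1) * x) * (1 + (w₂ ^ 2 - 1) * x)) ^ 2) x := fun x hx => by
    have d1 := hden w₁ hw₁ x hx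
    have d2 := hden w₂ hw₂ x hx
    exact AnalyticAt.div (by fun_prop) (by fun_prop) (by positivity)
  refine powersDecay_of_even (r := 1) (fun j => (hz j).1)
    (g := fun x => w₁ / (1 + (w₁ ^ 2 - 1) * x) + w₂ / (1 + (w₂ ^ 2 - 1) * x))
    (R := fun x => -(w₁ * (w₁ ^ 2 - 1) * (w₂ ^ 2 - w₁ ^ 2)) *
      (2 + (w₁ ^ 2 - 1 + (w₂ ^ 2 - 1)) * x) /
        ((1 + (w₁ ^ 2 - 1) * x) * (1 + (w₂ ^ 2 - 1) * x)) ^ 2) (fun θ => ?_)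
    (fun x hx => ?_) hRa (hR0 0 (by simp)) (hR0 1 (by simp)) (fun x hx => ?_)
  · have e1 := poisson_cayley (w := (w₁ : ℂ)) (by simpa using hw₁) θ
    have e2 := poisson_cayley (w := (w₂ : ℂ)) (by simpa using hw₂) θ
    simp only [Complex.ofReal_re, Complex.ofReal_im, zero_mul, sub_zero] at e1 e2
    simp [cayleyZeros, Fin.sum_univ_two, e1, e2]
  · have d1 := (hden w₁ hw₁ x hx).ne'
    have d2 := (hden w₂ hw₂ x hx).ne'
    have hd : ∀ w : ℝ, HasDerivAt (fun x => 1 + (w ^ 2 - 1) * x) (w ^ 2 - 1) x := fun w => by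
      simpa using ((hasDerivAt_id x).const_mul (w ^ 2 - 1)).const_add 1
    refine (((hasDerivAt_const x w₁).div (hd w₁) d1).add
      ((hasDerivAt_const x w₂).div (hd w₂) d2)).congr_deriv ?_
    have h3' : w₂ * (w₂ ^ 2 - 1) = -(w₁ * (w₁ ^ 2 - 1)) := by linear_combination -h3
    rw [zero_mul, zero_mul, zero_sub, zero_sub, h3']
    have e1 : 2 + (w₁ ^ 2 - 1 + (w₂ ^ 2 - 1)) * x =
        (1 + (w₁ ^ 2 - 1) * x) + (1 + (w₂ ^ 2 - 1) * x) := by ring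
    have e2 : x * (w₂ ^ 2 - w₁ ^ 2) = (1 + (w₂ ^ 2 - 1) * x) - (1 + (w₁ ^ 2 - 1) * x) := by ring
    have e3 : ∀ K δ b c : ℝ, x ^ 1 * (-(K * δ) * b / c) = -(K * (x * δ) * b / c) := by
      intros; ring
    rw [e1, e3, e2]
    generalize 1 + (w₁ ^ 2 - 1) * x = b₁ at *
    generalize 1 + (w₂ ^ 2 - 1) * x = b₂ at *
    generalize w₁ * (w₁ ^ 2 - 1) = K
    field_simp
    ring
  · have hx' := Ioo_subset_Icc_self hx
    rw [(hRa x hx').analyticOrderAt_eq_zero.2 (hR0 x hx')]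
    exact zero_le

/-- Over a common denominator the numerator of `g'` has degree at most `6` in `x`. The two equations
remove its constant and linear terms, so `r = 2`; the two inequalities say that the remaining
quartic does not vanish at `0` and `1`. -/
theorem powersDecay_two_conj_pairs {w₁ w₂ : ℂ} (h₁ : w₁ ≠ 1) (h₂ : w₂ ≠ 1) (hw₁ : 0 < w₁.re)
    (hw₂ : 0 < w₂.re) (h3 : (w₁ + w₂).re = (w₁ ^ 3 + w₂ ^ 3).re)
    (h5 : (w₁ ^ 3 + w₂ ^ 3).re = (w₁ ^ 5 + w₂ ^ 5).re)
    (h7 : (w₁ ^ 5 + w₂ ^ 5).re ≠ (w₁ ^ 7 + w₂ ^ 7).re)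
    (hinv : (w₁ ^ (-1 : ℤ) + w₂ ^ (-1 : ℤ)).re ≠ (w₁ ^ (-3 : ℤ) + w₂ ^ (-3 : ℤ)).re) :
    IsZeroTuple (cayleyZeros ![w₁, w₂, conj w₁, conj w₂]) ∧
      PowersDecay (blaschke (cayleyZeros ![w₁, w₂, conj w₁, conj w₂])) 7 := by
  have hz : IsZeroTuple (cayleyZeros ![w₁, w₂, conj w₁, conj w₂]) := by
    refine isZeroTuple_cayleyZeros (fun j => ?_) (fun j => ?_)
    · fin_cases j <;> simp [hw₁, hw₂]
    · fin_cases j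
      · exact h₁
      · exact h₂
      · exact fun h => h₁ (by simpa using congrArg conj h)
      · exact fun h => h₂ (by simpa using congrArg conj h)
  refine ⟨hz, ?_⟩
  simp only [Complex.add_re, re_pow_three, re_pow_five, re_pow_seven, re_zpow_neg_one,
    re_zpow_neg_three] at h3 h5 h7 hinv
  have hpair₁ := poisson_cayley_pair hw₁
  have hpair₂ := poisson_cayley_pair hw₂
  have hpos₁ : ∀ x ∈ Icc (0 : ℝ) 1, pairDen (w₁.re ^ 2 + w₁.im ^ 2 - 1) (4 * w₁.im ^ 2) x ≠ 0 :=
    fun x hx => (pairDen_pos hw₁ hx).ne'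
  have hpos₂ : ∀ x ∈ Icc (0 : ℝ) 1, pairDen (w₂.re ^ 2 + w₂.im ^ 2 - 1) (4 * w₂.im ^ 2) x ≠ 0 :=
    fun x hx => (pairDen_pos hw₂ hx).ne'
  set p₁ := w₁.re
  set q₁ := w₁.im
  set p₂ := w₂.re
  set q₂ := w₂.im
  set e₁ := p₁ ^ 2 + q₁ ^ 2 - 1 with he₁
  set e₂ := p₂ ^ 2 + q₂ ^ 2 - 1 with he₂
  set f₁ := 4 * q₁ ^ 2 with hf₁
  set f₂ := 4 * q₂ ^ 2 with hf₂
  set b₁ := 2 * e₁ - f₁ with hb₁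
  set b₂ := 2 * e₂ - f₂ with hb₂
  set c₁ := e₁ ^ 2 + f₁ with hc₁
  set c₂ := e₂ ^ 2 + f₂ with hc₂
  -- `t0`, `t1`, `t2` concern the Taylor coefficients of `g'/2` at `0`; `m1`, `m2` concern those of
  -- the numerator, obtained by multiplying with the squared denominators.
  have t0 : p₁ * (f₁ - e₁) + p₂ * (f₂ - e₂) = 0 := by
    simp only [he₁, he₂, hf₁, hf₂]; linear_combination h3
  have t1 : p₁ * (-2 * c₁ - 2 * b₁ * (f₁ - e₁)) + p₂ * (-2 * c₂ - 2 * b₂ * (f₂ - e₂)) = 0 := by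
    simp only [hb₁, hb₂, hc₁, hc₂, he₁, he₂, hf₁, hf₂]; linear_combination 2 * h3 - 2 * h5
  have m1 : p₁ * (-2 * c₁ + 2 * b₂ * (f₁ - e₁)) + p₂ * (-2 * c₂ + 2 * b₁ * (f₂ - e₂)) = 0 := by
    linear_combination t1 + 2 * (b₁ + b₂) * t0
  -- Coefficients of `x²` to `x⁶` in the numerator.
  set r : Fin 5 → ℝ := ![
    p₁ * (-e₁ * c₁ - 4 * b₂ * c₁ + (b₂ ^ 2 + 2 * c₂) * (f₁ - e₁)) +
      p₂ * (-e₂ * c₂ - 4 * b₁ * c₂ + (b₁ ^ 2 + 2 * c₁) * (f₂ - e₂)),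
    p₁ * (-2 * b₂ * e₁ * c₁ - 2 * (b₂ ^ 2 + 2 * c₂) * c₁ + 2 * b₂ * c₂ * (f₁ - e₁)) +
      p₂ * (-2 * b₁ * e₂ * c₂ - 2 * (b₁ ^ 2 + 2 * c₁) * c₂ + 2 * b₁ * c₁ * (f₂ - e₂)),
    p₁ * (-(b₂ ^ 2 + 2 * c₂) * e₁ * c₁ - 4 * b₂ * c₂ * c₁ + c₂ ^ 2 * (f₁ - e₁)) +
      p₂ * (-(b₁ ^ 2 + 2 * c₁) * e₂ * c₂ - 4 * b₁ * c₁ * c₂ + c₁ ^ 2 * (f₂ - e₂)),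
    p₁ * (-2 * b₂ * c₂ * e₁ * c₁ - 2 * c₂ ^ 2 * c₁) +
      p₂ * (-2 * b₁ * c₁ * e₂ * c₂ - 2 * c₁ ^ 2 * c₂),
    -(p₁ * c₂ ^ 2 * e₁ * c₁) - p₂ * c₁ ^ 2 * e₂ * c₂] with hr
  set P : Polynomial ℝ := Polynomial.C (r 0) + Polynomial.C (r 1) * Polynomial.X +
    Polynomial.C (r 2) * Polynomial.X ^ 2 + Polynomial.C (r 3) * Polynomial.X ^ 3 +
    Polynomial.C (r 4) * Polynomial.X ^ 4 with hP
  have hPeval : ∀ x, P.eval x = r 0 + r 1 * x + r 2 * x ^ 2 + r 3 * x ^ 3 + r 4 * x ^ 4 := by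
    intro x; simp [hP]
  have hkey : ∀ x, x ^ 2 * P.eval x = p₁ * pairNum e₁ f₁ x * pairDen e₂ f₂ x ^ 2 +
      p₂ * pairNum e₂ f₂ x * pairDen e₁ f₁ x ^ 2 := by
    intro x
    rw [hPeval]
    unfold pairNum pairDen
    simp only [← hb₁, ← hb₂, ← hc₁, ← hc₂, hr, Matrix.cons_val]
    linear_combination -t0 - x * m1
  have hr0 : P.eval 0 ≠ 0 := by
    have t2 : p₁ * (-e₁ * c₁ + 4 * b₁ * c₁ + (3 * b₁ ^ 2 - 2 * c₁) * (f₁ - e₁)) +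
        p₂ * (-e₂ * c₂ + 4 * b₂ * c₂ + (3 * b₂ ^ 2 - 2 * c₂) * (f₂ - e₂)) =
        3 * ((p₁ ^ 5 - 10 * p₁ ^ 3 * q₁ ^ 2 + 5 * p₁ * q₁ ^ 4 +
          (p₂ ^ 5 - 10 * p₂ ^ 3 * q₂ ^ 2 + 5 * p₂ * q₂ ^ 4)) -
          (p₁ ^ 7 - 21 * p₁ ^ 5 * q₁ ^ 2 + 35 * p₁ ^ 3 * q₁ ^ 4 - 7 * p₁ * q₁ ^ 6 +
          (p₂ ^ 7 - 21 * p₂ ^ 5 * q₂ ^ 2 + 35 * p₂ ^ 3 * q₂ ^ 4 - 7 * p₂ * q₂ ^ 6))) := by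
      simp only [hb₁, hb₂, hc₁, hc₂, he₁, he₂, hf₁, hf₂]
      linear_combination 3 * h3 - 6 * h5
    have m2 : r 0 = 3 * ((p₁ ^ 5 - 10 * p₁ ^ 3 * q₁ ^ 2 + 5 * p₁ * q₁ ^ 4 +
          (p₂ ^ 5 - 10 * p₂ ^ 3 * q₂ ^ 2 + 5 * p₂ * q₂ ^ 4)) -
          (p₁ ^ 7 - 21 * p₁ ^ 5 * q₁ ^ 2 + 35 * p₁ ^ 3 * q₁ ^ 4 - 7 * p₁ * q₁ ^ 6 +
          (p₂ ^ 7 - 21 * p₂ ^ 5 * q₂ ^ 2 + 35 * p₂ ^ 3 * q₂ ^ 4 - 7 * p₂ * q₂ ^ 6))) := by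
      rw [← t2]
      simp only [hr, Matrix.cons_val]
      linear_combination 2 * (b₁ + b₂) * t1 +
        (b₁ ^ 2 + 2 * c₁ + b₂ ^ 2 + 2 * c₂ + 4 * b₁ * b₂) * t0
    rw [hPeval, m2]
    have := sub_ne_zero.2 h7
    simpa using this
  have hr1 : P.eval 1 ≠ 0 := by
    have hk := hkey 1
    have hm : ∀ p q : ℝ, pairDen (p ^ 2 + q ^ 2 - 1) (4 * q ^ 2) 1 = (p ^ 2 + q ^ 2) ^ 2 := by
      intros; unfold pairDen; ring
    rw [hm, hm] at hk
    have hμ₁ : p₁ ^ 2 + q₁ ^ 2 ≠ 0 := by positivity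
    have hμ₂ : p₂ ^ 2 + q₂ ^ 2 ≠ 0 := by positivity
    intro h0
    rw [h0] at hk
    apply hinv
    have hs : ∀ p q : ℝ, p ^ 2 + q ^ 2 ≠ 0 →
        p / (p ^ 2 + q ^ 2) - (p ^ 3 - 3 * p * q ^ 2) / (p ^ 2 + q ^ 2) ^ 3 =
          -(p * pairNum (p ^ 2 + q ^ 2 - 1) (4 * q ^ 2) 1) / (p ^ 2 + q ^ 2) ^ 4 := by
      intro p q h
      unfold pairNum
      field_simp
      ring
    have hs₁ := hs p₁ q₁ hμ₁
    have hs₂ := hs p₂ q₂ hμ₂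
    have hsum : -(p₁ * pairNum e₁ f₁ 1) / (p₁ ^ 2 + q₁ ^ 2) ^ 4 +
        -(p₂ * pairNum e₂ f₂ 1) / (p₂ ^ 2 + q₂ ^ 2) ^ 4 = 0 := by
      rw [div_add_div _ _ (pow_ne_zero 4 hμ₁) (pow_ne_zero 4 hμ₂), div_eq_zero_iff]
      left
      linear_combination hk
    linear_combination hs₁ + hs₂ + hsum
  have hP0 : P ≠ 0 := fun h => hr0 (by rw [h, Polynomial.eval_zero])
  have hdeg : P.natDegree ≤ 4 := by rw [hP]; compute_degree
  set U : ℝ → ℝ := fun x => 2 / (pairDen e₁ f₁ x * pairDen e₂ f₂ x) ^ 2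
  have hU0 : ∀ x ∈ Icc (0 : ℝ) 1, U x ≠ 0 := fun x hx =>
    div_ne_zero two_ne_zero (pow_ne_zero 2 (mul_ne_zero (hpos₁ x hx) (hpos₂ x hx)))
  have hUa : ∀ x ∈ Icc (0 : ℝ) 1, AnalyticAt ℝ U x := fun x hx =>
    analyticAt_const.div (((analyticAt_pairDen e₁ f₁ x).fun_mul
      (analyticAt_pairDen e₂ f₂ x)).fun_pow 2)
      (pow_ne_zero 2 (mul_ne_zero (hpos₁ x hx) (hpos₂ x hx)))
  have hPa : ∀ x, AnalyticAt ℝ (fun y => P.eval y) x := fun x =>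
    AnalyticOnNhd.eval_polynomial P x (mem_univ x)
  refine powersDecay_of_even (r := 2) (fun j => (hz j).1)
    (g := fun x => 2 * p₁ * (1 + e₁ * x) / pairDen e₁ f₁ x +
      2 * p₂ * (1 + e₂ * x) / pairDen e₂ f₂ x)
    (R := fun x => U x * P.eval x) (fun θ => ?_)
    (fun x hx => ?_) (fun x hx => (hUa x hx).mul (hPa x))
    (mul_ne_zero (hU0 0 (by simp)) hr0) (mul_ne_zero (hU0 1 (by simp)) hr1) (fun x hx => ?_)
  · rw [← hpair₁ θ, ← hpair₂ θ]
    simp [cayleyZeros, Fin.sum_univ_four]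
    ring
  · refine ((hasDerivAt_pair p₁ e₁ f₁ (hpos₁ x hx)).add
      (hasDerivAt_pair p₂ e₂ f₂ (hpos₂ x hx))).congr_deriv ?_
    have d₁ := hpos₁ x hx
    have d₂ := hpos₂ x hx
    have e : x ^ 2 * (U x * P.eval x) = U x * (x ^ 2 * P.eval x) := by ring
    rw [e, hkey]
    simp only [U]
    generalize pairDen e₁ f₁ x = D₁ at *
    generalize pairDen e₂ f₂ x = D₂ at *
    field_simp
  · have hx' := Ioo_subset_Icc_self hx
    rw [analyticOrderAt_mul_of_ne_zero (hUa x hx') (hPa x) (hU0 x hx')]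
    -- Inside the interval the crude bound by the degree suffices: `4 ≤ 2 * 2 + 1`.
    refine (analyticOrderAt_eval_le hP0 x).trans ?_
    exact_mod_cast hdeg.trans (by norm_num)

/-! ### Zeros built from roots of unity -/

lemma IsPrimitiveRoot.prod_one_sub_mul_pow_succ {N : ℕ} (hN : 0 < N) {u : ℂ}
    (hu : IsPrimitiveRoot u N) (y : ℂ) :
    ∏ j : Fin N, (1 - y * u ^ ((j : ℕ) + 1)) = 1 - y ^ N := by
  have hinj : Function.Injective (fun j : Fin N => u ^ ((j : ℕ) + 1)) := by
    intro i j hij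
    have h : u ^ (i : ℕ) = u ^ (j : ℕ) :=
      mul_right_cancel₀ (hu.ne_zero hN.ne') (by simpa [pow_succ] using hij)
    exact Fin.ext (hu.pow_inj i.2 j.2 h)
  have himg : Finset.univ.image (fun j : Fin N => u ^ ((j : ℕ) + 1)) =
      Polynomial.nthRootsFinset N 1 := by
    refine Finset.eq_of_subset_of_card_le ?_ ?_
    · intro x hx
      obtain ⟨j, -, rfl⟩ := Finset.mem_image.1 hx
      rw [Polynomial.mem_nthRootsFinset hN]
      rw [← pow_mul, mul_comm, pow_mul, hu.pow_eq_one, one_pow]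
    · rw [hu.card_nthRootsFinset, Finset.card_image_of_injective _ hinj]
      simp
  have := hu.pow_sub_pow_eq_prod_sub_mul 1 y hN
  rw [← himg, Finset.prod_image (fun i _ j _ h => hinj h), one_pow] at this
  rw [this]
  exact Finset.prod_congr rfl fun j _ => by ring

/-- The curve `exp (iNθ/2) (N z - 1 + w) / (1 - w)²`, `z = exp (iθ)`, `w = κ (z - 1) ^ N`, as a
function of a complex variable `θ`. -/
noncomputable def rootCurve (N : ℕ) (κ θ : ℂ) : ℂ :=
  Complex.exp (Complex.I * (N / 2 * θ)) *
    (N * Complex.exp (Complex.I * θ) - 1 + κ * (Complex.exp (Complex.I * θ) - 1) ^ N) /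
      (1 - κ * (Complex.exp (Complex.I * θ) - 1) ^ N) ^ 2

lemma norm_exp_sub_one_le (θ : ℝ) : ‖Complex.exp (Complex.I * θ) - 1‖ ≤ 2 := by
  refine (norm_sub_le _ _).trans ?_
  rw [norm_exp_I_mul, norm_one]
  norm_num

lemma exp_I_mul_sub_one (θ : ℝ) : Complex.exp (Complex.I * θ) - 1 =
    2 * Complex.I * Real.sin (θ / 2) * Complex.exp (Complex.I * (θ / 2)) := by
  have h := Complex.exp_mul_I ((θ / 2 : ℝ) : ℂ)
  have h2 : Complex.exp (Complex.I * θ) = Complex.exp (((θ / 2 : ℝ) : ℂ) * Complex.I) ^ 2 := by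
    rw [← Complex.exp_nat_mul]
    congr 1
    push_cast
    ring
  have h3 : Complex.I * ((θ : ℂ) / 2) = ((θ / 2 : ℝ) : ℂ) * Complex.I := by push_cast; ring
  have h4 : (1 : ℂ) = Complex.cos ((θ / 2 : ℝ) : ℂ) ^ 2 + Complex.sin ((θ / 2 : ℝ) : ℂ) ^ 2 := by
    rw [add_comm, Complex.sin_sq_add_cos_sq]
  rw [h2, h3, h, Complex.ofReal_sin]
  linear_combination -h4 + Complex.sin ((θ / 2 : ℝ) : ℂ) ^ 2 * (1 - 2) * Complex.I_sq

lemma norm_mul_exp_sub_one_pow_le {N : ℕ} {κ : ℂ} {t : ℝ} (ht : ‖κ‖ = t ^ N) (ht0 : 0 ≤ t)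
    (θ : ℝ) : ‖κ * (Complex.exp (Complex.I * θ) - 1) ^ N‖ ≤ (2 * t) ^ N := by
  rw [norm_mul, norm_pow, ht, mul_comm, mul_pow]
  gcongr
  exact norm_exp_sub_one_le θ

/-- Perturbation estimates for the curve `rootCurve` and its derivative. -/
lemma norm_perturbation_le {g z w w' : ℂ} {N ρ : ℝ} (hN : 3 ≤ N) (hg : ‖g‖ = 1) (hz : ‖z‖ = 1)
    (hw : ‖w‖ ≤ ρ) (hw' : ‖w'‖ ≤ N * ρ) (hρ : 100 * N ^ 2 * ρ ≤ 1) :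
    ‖g * (N * z - 1 + w) / (1 - w) ^ 2 - g * (N * z - 1)‖ ≤ 1 / 2 ∧
    ‖(Complex.I * (N / 2) * (g * (N * z - 1 + w) / (1 - w) ^ 2) +
      g * ((N * (Complex.I * z) + w') / (1 - w) ^ 2 + 2 * (N * z - 1 + w) * w' / (1 - w) ^ 3)) -
      (Complex.I * (N / 2) * (g * (N * z - 1)) + g * (N * (Complex.I * z)))‖ ≤ 1 / 2 := by
  have hρ0 : 0 ≤ ρ := (norm_nonneg w).trans hw
  have hNρ : 300 * (N * ρ) ≤ 1 := by nlinarith [mul_nonneg (by linarith : 0 ≤ N) hρ0]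
  have hρ1 : 900 * ρ ≤ 1 := by nlinarith
  have hsub : 1 - ρ ≤ ‖1 - w‖ := by
    have := norm_sub_norm_le (1 : ℂ) w
    rw [norm_one] at this
    linarith
  have hne : 1 - w ≠ 0 := by
    rw [← norm_pos_iff]; linarith
  -- Both differences are polynomial in `Y`, and `Y² - 1 = O(ρ)`; the hypothesis on `ρ` leaves ample
  -- room below `1/2`.
  set Y := (1 - w)⁻¹ with hY
  have hYle : ‖Y‖ ≤ 11 / 10 := by
    rw [hY, norm_inv, inv_le_comm₀ (norm_pos_iff.2 hne) (by norm_num)]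
    refine le_trans ?_ hsub
    norm_num
    linarith
  have hY1 : Y - 1 = w * Y := by rw [hY]; field_simp; ring
  have hY2 : ‖Y ^ 2 - 1‖ ≤ 3 * ρ := by
    have e : Y ^ 2 - 1 = w * (Y * (Y + 1)) := by linear_combination (Y + 1) * hY1
    rw [e, norm_mul, norm_mul, mul_comm (3 : ℝ)]
    have h1 : ‖Y + 1‖ ≤ 21 / 10 := by
      refine (norm_add_le _ _).trans ?_
      rw [norm_one]; linarith
    calc ‖w‖ * (‖Y‖ * ‖Y + 1‖) ≤ ρ * (11 / 10 * (21 / 10)) := by gcongr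
      _ ≤ ρ * 3 := by gcongr; norm_num
  have hYsq : ‖Y ^ 2‖ ≤ 2 := by
    rw [norm_pow]
    calc ‖Y‖ ^ 2 ≤ (11 / 10) ^ 2 := by gcongr
      _ ≤ 2 := by norm_num
  have hYcu : ‖Y ^ 3‖ ≤ 2 := by
    rw [norm_pow]
    calc ‖Y‖ ^ 3 ≤ (11 / 10) ^ 3 := by gcongr
      _ ≤ 2 := by norm_num
  have hNn : ‖(N : ℂ)‖ = N := by
    rw [Complex.norm_real, Real.norm_of_nonneg (by linarith)]
  have hQ0 : ‖(N : ℂ) * z - 1‖ ≤ N + 1 := by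
    refine (norm_sub_le _ _).trans ?_
    rw [norm_mul, hNn, hz, norm_one, mul_one]
  have hQ : ‖(N : ℂ) * z - 1 + w‖ ≤ N + 2 := by
    refine (norm_add_le _ _).trans ?_
    linarith
  have hA : ‖((N : ℂ) * z - 1 + w) * Y ^ 2 - (N * z - 1)‖ ≤ 5 * (N * ρ) := by
    have e : ((N : ℂ) * z - 1 + w) * Y ^ 2 - (N * z - 1) = w * Y ^ 2 + (N * z - 1) * (Y ^ 2 - 1) := by
      ring
    rw [e]
    refine (norm_add_le _ _).trans ?_
    rw [norm_mul, norm_mul]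
    calc ‖w‖ * ‖Y ^ 2‖ + ‖(N : ℂ) * z - 1‖ * ‖Y ^ 2 - 1‖ ≤ ρ * 2 + (N + 1) * (3 * ρ) := by gcongr
      _ ≤ 5 * (N * ρ) := by nlinarith
  constructor
  · have e : g * (N * z - 1 + w) / (1 - w) ^ 2 - g * (N * z - 1) =
        g * (((N : ℂ) * z - 1 + w) * Y ^ 2 - (N * z - 1)) := by
      rw [hY]; field_simp
    rw [e, norm_mul, hg, one_mul]
    linarith
  · have e : (Complex.I * (N / 2) * (g * (N * z - 1 + w) / (1 - w) ^ 2) +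
      g * ((N * (Complex.I * z) + w') / (1 - w) ^ 2 + 2 * (N * z - 1 + w) * w' / (1 - w) ^ 3)) -
      (Complex.I * (N / 2) * (g * (N * z - 1)) + g * (N * (Complex.I * z))) =
      g * (Complex.I * (N / 2) * (((N : ℂ) * z - 1 + w) * Y ^ 2 - (N * z - 1)) +
        N * (Complex.I * z) * (Y ^ 2 - 1) + w' * Y ^ 2 + 2 * (N * z - 1 + w) * w' * Y ^ 3) := by
      rw [hY]; field_simp; ring
    rw [e, norm_mul, hg, one_mul]
    refine (norm_add_le _ _).trans ?_
    have h1 := norm_add₃_le (a := Complex.I * (N / 2) * (((N : ℂ) * z - 1 + w) * Y ^ 2 - (N * z - 1)))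
      (b := N * (Complex.I * z) * (Y ^ 2 - 1)) (c := w' * Y ^ 2)
    have b1 : ‖Complex.I * (N / 2) * (((N : ℂ) * z - 1 + w) * Y ^ 2 - (N * z - 1))‖ ≤
        N / 2 * (5 * (N * ρ)) := by
      rw [norm_mul, norm_mul, Complex.norm_I, one_mul, norm_div, hNn, Complex.norm_two]
      gcongr
    have b2 : ‖(N : ℂ) * (Complex.I * z) * (Y ^ 2 - 1)‖ ≤ N * (3 * ρ) := by
      rw [norm_mul, norm_mul, norm_mul, Complex.norm_I, hNn, hz, one_mul, mul_one]
      gcongr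
    have b3 : ‖w' * Y ^ 2‖ ≤ N * ρ * 2 := by
      rw [norm_mul]; gcongr
    have b4 : ‖2 * ((N : ℂ) * z - 1 + w) * w' * Y ^ 3‖ ≤ 2 * (N + 2) * (N * ρ) * 2 := by
      rw [norm_mul, norm_mul, norm_mul, Complex.norm_two]; gcongr
    nlinarith

/-- For `κ = 0` the real part of the curve is `N cos a - cos b` and its derivative is, up to sign,
the quantity in `h1`. If both were small, then `9 = 9(cos² a + sin² a)` would be at most `2(1/4 +
1/9) + 2`. -/
lemma rootCurve_zeros_simple {a b N : ℝ} (hN : 3 ≤ N)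
    (h0 : |N * Real.cos a - Real.cos b| ≤ 1 / 2)
    (h1 : |N / 2 * ((N + 2) * Real.sin a - Real.sin b)| ≤ 1 / 2) : False := by
  have h2 : |(N + 2) * Real.sin a - Real.sin b| ≤ 1 / 3 := by
    rw [abs_mul, abs_of_nonneg (by linarith)] at h1
    nlinarith [abs_nonneg ((N + 2) * Real.sin a - Real.sin b)]
  have ha := Real.sin_sq_add_cos_sq a
  have hb := Real.sin_sq_add_cos_sq b
  have e0 : (N * Real.cos a - Real.cos b) ^ 2 ≤ (1 / 2) ^ 2 := sq_le_sq' (abs_le.1 h0).1 (abs_le.1 h0).2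
  have e2 : ((N + 2) * Real.sin a - Real.sin b) ^ 2 ≤ (1 / 3) ^ 2 :=
    sq_le_sq' (abs_le.1 h2).1 (abs_le.1 h2).2
  have f0 : (N * Real.cos a) ^ 2 ≤ 2 * (N * Real.cos a - Real.cos b) ^ 2 + 2 * Real.cos b ^ 2 := by
    nlinarith [sq_nonneg (N * Real.cos a - 2 * Real.cos b)]
  have f2 : ((N + 2) * Real.sin a) ^ 2 ≤
      2 * ((N + 2) * Real.sin a - Real.sin b) ^ 2 + 2 * Real.sin b ^ 2 := by
    nlinarith [sq_nonneg ((N + 2) * Real.sin a - 2 * Real.sin b)]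
  have g0 : 9 * Real.cos a ^ 2 ≤ (N * Real.cos a) ^ 2 := by
    rw [mul_pow]; gcongr; nlinarith
  have g2 : 9 * Real.sin a ^ 2 ≤ ((N + 2) * Real.sin a) ^ 2 := by
    rw [mul_pow]; gcongr; nlinarith
  linarith

lemma hasDerivAt_mul_exp_sub_one_pow (κ : ℂ) (n : ℕ) (θ : ℝ) :
    HasDerivAt (fun θ : ℝ => κ * (Complex.exp (Complex.I * θ) - 1) ^ (n + 1))
      (κ * ((n + 1 : ℕ) * (Complex.exp (Complex.I * θ) - 1) ^ n *
        (Complex.I * Complex.exp (Complex.I * θ)))) θ :=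
  (((hasDerivAt_exp_I_mul θ).sub_const 1).fun_pow (n + 1)).const_mul κ

lemma hasDerivAt_rootCurve {N : ℕ} {κ w' : ℂ} {θ : ℝ}
    (hw : HasDerivAt (fun θ : ℝ => κ * (Complex.exp (Complex.I * θ) - 1) ^ N) w' θ)
    (hne : 1 - κ * (Complex.exp (Complex.I * θ) - 1) ^ N ≠ 0) :
    HasDerivAt (fun θ : ℝ => rootCurve N κ θ)
      (Complex.I * (N / 2) * rootCurve N κ θ + Complex.exp (Complex.I * (N / 2 * θ)) *
        ((N * (Complex.I * Complex.exp (Complex.I * θ)) + w') /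
          (1 - κ * (Complex.exp (Complex.I * θ) - 1) ^ N) ^ 2 +
        2 * (N * Complex.exp (Complex.I * θ) - 1 + κ * (Complex.exp (Complex.I * θ) - 1) ^ N) * w' /
          (1 - κ * (Complex.exp (Complex.I * θ) - 1) ^ N) ^ 3)) θ := by
  have h1 : HasDerivAt (fun θ : ℝ => Complex.exp (Complex.I * (N / 2 * θ)))
      (Complex.exp (Complex.I * (N / 2 * θ)) * (Complex.I * (N / 2))) θ := by
    refine ((((hasDerivAt_id θ).ofReal_comp).const_mul ((N : ℂ) / 2)).const_mul
      Complex.I).cexp.congr_deriv ?_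
    simp
  have h2 := (((hasDerivAt_exp_I_mul θ).const_mul (N : ℂ)).sub_const 1).fun_add hw
  have h3 := (hw.const_sub 1).fun_pow 2
  refine ((h1.fun_mul h2).fun_div h3 (pow_ne_zero 2 hne)).congr_deriv ?_
  unfold rootCurve
  generalize 1 - κ * (Complex.exp (Complex.I * θ) - 1) ^ N = Y at *
  generalize κ * (Complex.exp (Complex.I * θ) - 1) ^ N = w at *
  field_simp
  ring

/-- The second derivative of the argument in terms of `rootCurve`. -/
lemma im_eq_sin_pow_mul_re_rootCurve (n : ℕ) (t θ : ℝ) :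
    ((t ^ (n + 2) * Complex.I ^ (n + 1)) * Complex.exp (Complex.I * θ) *
      (Complex.exp (Complex.I * θ) - 1) ^ n *
      (((n + 2 : ℕ) : ℂ) * Complex.exp (Complex.I * θ) - 1 +
        (t ^ (n + 2) * Complex.I ^ (n + 1)) * (Complex.exp (Complex.I * θ) - 1) ^ (n + 2)) /
      (1 - (t ^ (n + 2) * Complex.I ^ (n + 1)) *
        (Complex.exp (Complex.I * θ) - 1) ^ (n + 2)) ^ 2).im =
    (t ^ (n + 2) * (-2) ^ n) * Real.sin (θ / 2) ^ n *
      (rootCurve (n + 2) (t ^ (n + 2) * Complex.I ^ (n + 1)) θ).re := by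
  set κ : ℂ := t ^ (n + 2) * Complex.I ^ (n + 1) with hκ
  have hfac : κ * Complex.exp (Complex.I * θ) * (Complex.exp (Complex.I * θ) - 1) ^ n =
      (((t ^ (n + 2) * (-2) ^ n) * Real.sin (θ / 2) ^ n : ℝ) : ℂ) * Complex.I *
        Complex.exp (Complex.I * (((n + 2 : ℕ) : ℂ) / 2 * θ)) := by
    have he : Complex.exp (Complex.I * θ) * Complex.exp (Complex.I * (θ / 2)) ^ n =
        Complex.exp (Complex.I * (((n + 2 : ℕ) : ℂ) / 2 * θ)) := by
      rw [← Complex.exp_nat_mul, ← Complex.exp_add]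
      congr 1
      push_cast
      ring
    -- The phase of `κ` is chosen for this: the powers of `i` from `κ` and from `(z-1)^n` combine to
    -- a real number times one `i`, which turns the imaginary part into a real part.
    have hI : (Complex.I ^ n) * Complex.I ^ n * 2 ^ n = (-2) ^ n := by
      rw [← mul_pow, ← mul_pow, Complex.I_mul_I]; norm_num
    rw [exp_I_mul_sub_one θ, ← he, hκ]
    push_cast
    rw [← hI]
    ring
  rw [mul_div_assoc, hfac, rootCurve]
  rw [mul_div_assoc, mul_assoc, mul_assoc, Complex.im_ofReal_mul, Complex.I_mul_im]

/-- Here `N = n + 2`. The logarithm of the whole product is explicit, and `ψ''` is `sin(θ/2)^n`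
times a constant multiple of the real part of `rootCurve`. That real part is nonzero at `z = 1` and
has only simple zeros elsewhere. -/
theorem exists_arg_rootZeros_aux {n : ℕ} (hn : 1 ≤ n) {σ : Fin (n + 2) → ℂ} {t : ℝ}
    (hσ : ∀ j, ‖σ j‖ < 1)
    (ht : 0 < t) (ht1 : 100 * ((n + 2 : ℕ) : ℝ) ^ 2 * (2 * t) ≤ 1)
    (hprod : ∀ θ : ℝ, ∏ j, (1 - conj (σ j) * Complex.exp (Complex.I * θ)) =
      (1 - (t ^ (n + 2) * Complex.I ^ (n + 1)) * (Complex.exp (Complex.I * θ) - 1) ^ (n + 2)) /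
        (1 - (t ^ (n + 2) * Complex.I ^ (n + 1)) * (-1) ^ (n + 2))) :
    PowersDecay (blaschke σ) (n + 2) ∧
      ∃ ψ : ℝ → ℝ, IsContinuousArg (blaschke σ) ψ ∧ ContDiff ℝ ∞ ψ ∧
        VanishesToOrder (iteratedDeriv 2 ψ) 0 n ∧
        ∀ θ : ℝ, ∃ k : ℕ, k ≤ n ∧ VanishesToOrder (iteratedDeriv 2 ψ) θ k := by
  set κ : ℂ := t ^ (n + 2) * Complex.I ^ (n + 1) with hκ
  have hκn : ‖κ‖ = t ^ (n + 2) := by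
    rw [hκ, norm_mul, norm_pow, norm_pow, Complex.norm_I, one_pow, mul_one, Complex.norm_real,
      Real.norm_of_nonneg ht.le]
  have hN1 : (3 : ℝ) ≤ ((n + 2 : ℕ) : ℝ) := by exact_mod_cast (by omega : 3 ≤ n + 2)
  have h2t : 2 * t < 1 := by nlinarith
  set ρ := (2 * t) ^ (n + 2) with hρdef
  have hρ : 100 * ((n + 2 : ℕ) : ℝ) ^ 2 * ρ ≤ 1 := by
    refine le_trans ?_ ht1
    gcongr
    exact pow_le_of_le_one (by positivity) h2t.le (by omega)
  have hρ1 : ρ < 1 := pow_lt_one₀ (by positivity) h2t (by omega)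
  have hwle : ∀ θ : ℝ, ‖κ * (Complex.exp (Complex.I * θ) - 1) ^ (n + 2)‖ ≤ ρ := fun θ =>
    norm_mul_exp_sub_one_pow_le hκn ht.le θ
  have hslit : ∀ θ : ℝ, 1 - κ * (Complex.exp (Complex.I * θ) - 1) ^ (n + 2) ∈ Complex.slitPlane :=
    fun θ => one_sub_mem_slitPlane ((hwle θ).trans_lt hρ1)
  have hne : ∀ θ : ℝ, 1 - κ * (Complex.exp (Complex.I * θ) - 1) ^ (n + 2) ≠ 0 := fun θ =>
    Complex.slitPlane_ne_zero (hslit θ)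
  have hc : 1 - κ * (-1) ^ (n + 2) ≠ 0 := by
    refine Complex.slitPlane_ne_zero (one_sub_mem_slitPlane ?_)
    rw [norm_mul, norm_pow, norm_neg, norm_one, one_pow, mul_one, hκn]
    exact pow_lt_one₀ ht.le (by linarith) (by omega)
  set w' : ℝ → ℂ := fun θ => κ * ((n + 1 + 1 : ℕ) * (Complex.exp (Complex.I * θ) - 1) ^ (n + 1) *
        (Complex.I * Complex.exp (Complex.I * θ)))
  have hwd : ∀ θ : ℝ, HasDerivAt
      (fun θ : ℝ => κ * (Complex.exp (Complex.I * θ) - 1) ^ (n + 2)) (w' θ) θ := fun θ =>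
    hasDerivAt_mul_exp_sub_one_pow κ (n + 1) θ
  set l : ℝ → ℂ := fun θ => Complex.log (1 - κ * (Complex.exp (Complex.I * θ) - 1) ^ (n + 2)) -
    Complex.log (1 - κ * (-1) ^ (n + 2))
  have hl : ∀ θ, HasDerivAt l
      (-w' θ / (1 - κ * (Complex.exp (Complex.I * θ) - 1) ^ (n + 2))) θ := fun θ =>
    (((hwd θ).const_sub 1).clog_real (hslit θ)).sub_const _
  have harg : IsContinuousArg (blaschke σ) (fun θ => ((n + 2 : ℕ) : ℝ) * θ - 2 * (l θ).im) :=
    isContinuousArg_of_exp (continuous_iff_continuousAt.2 fun θ => (hl θ).continuousAt) fun θ => by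
      rw [Complex.exp_sub, Complex.exp_log (hne θ), Complex.exp_log hc, hprod]
  set D : ℝ → ℝ := fun θ => ((n + 2 : ℕ) : ℝ) +
    2 * (w' θ / (1 - κ * (Complex.exp (Complex.I * θ) - 1) ^ (n + 2))).im
  have hD : ∀ θ, HasDerivAt (fun θ => ((n + 2 : ℕ) : ℝ) * θ - 2 * (l θ).im) (D θ) θ := fun θ => by
    have him : HasDerivAt (fun θ => (l θ).im) _ θ :=
      Complex.imCLM.hasFDerivAt.comp_hasDerivAt θ (hl θ)
    refine (((hasDerivAt_id θ).const_mul ((n + 2 : ℕ) : ℝ)).sub (him.const_mul 2)).congr_deriv ?_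
    simp only [D, neg_div, Complex.imCLM_apply, Complex.neg_im]
    ring
  set h : ℝ → ℝ := fun θ => (rootCurve (n + 2) κ θ).re
  set C : ℝ := -2 * ((n + 2 : ℕ) : ℝ) * (t ^ (n + 2) * (-2) ^ n)
  have hC : C ≠ 0 := by
    refine mul_ne_zero (mul_ne_zero (by norm_num) (by positivity)) (mul_ne_zero (by positivity)
      (pow_ne_zero _ (by norm_num)))
  set E : ℝ → ℝ := fun θ => C * h θ * Real.sin (θ / 2) ^ n
  have hE : ∀ θ, HasDerivAt D (E θ) θ := fun θ => by
    have hw'd : HasDerivAt w' (κ * ((n + 2 : ℕ) * ((n + 1 : ℕ) *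
        (Complex.exp (Complex.I * θ) - 1) ^ n * (Complex.I * Complex.exp (Complex.I * θ))) *
        (Complex.I * Complex.exp (Complex.I * θ)) +
        (n + 2 : ℕ) * (Complex.exp (Complex.I * θ) - 1) ^ (n + 1) *
        (Complex.I * (Complex.I * Complex.exp (Complex.I * θ))))) θ :=
      (((((hasDerivAt_exp_I_mul θ).sub_const 1).fun_pow (n + 1)).const_mul
        ((n + 2 : ℕ) : ℂ)).fun_mul ((hasDerivAt_exp_I_mul θ).const_mul Complex.I)).const_mul κ
    have hq := hw'd.fun_div ((hwd θ).const_sub 1) (hne θ)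
    have him : HasDerivAt
        (fun θ : ℝ => (w' θ / (1 - κ * (Complex.exp (Complex.I * θ) - 1) ^ (n + 2))).im) _ θ :=
      Complex.imCLM.hasFDerivAt.comp_hasDerivAt θ hq
    refine ((him.const_mul 2).const_add ((n + 2 : ℕ) : ℝ)).congr_deriv ?_
    have hkey := im_eq_sin_pow_mul_re_rootCurve n t θ
    rw [← hκ] at hkey
    have e : E θ = 2 * (((-(n + 2 : ℕ) : ℝ) : ℂ) * (κ * Complex.exp (Complex.I * θ) *
      (Complex.exp (Complex.I * θ) - 1) ^ n *
      (((n + 2 : ℕ) : ℂ) * Complex.exp (Complex.I * θ) - 1 +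
        κ * (Complex.exp (Complex.I * θ) - 1) ^ (n + 2)) /
      (1 - κ * (Complex.exp (Complex.I * θ) - 1) ^ (n + 2)) ^ 2)).im := by
      rw [Complex.im_ofReal_mul, hkey]
      simp only [E, C, h]
      ring
    rw [e, Complex.imCLM_apply]
    congr 2
    rw [← mul_div_assoc]
    congr 1
    simp only [w']
    push_cast
    linear_combination (κ * (n + 2) * Complex.exp (Complex.I * θ) *
      (Complex.exp (Complex.I * θ) - 1) ^ n * ((n + 1) * Complex.exp (Complex.I * θ) +
        (Complex.exp (Complex.I * θ) - 1) + κ * (Complex.exp (Complex.I * θ) - 1) ^ (n + 2))) *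
        Complex.I_sq
  have hha : ∀ θ, AnalyticAt ℝ h θ := fun θ => by
    have : AnalyticAt ℂ (rootCurve (n + 2) κ) θ := by
      unfold rootCurve
      exact AnalyticAt.fun_div (by fun_prop) (by fun_prop) (pow_ne_zero 2 (hne θ))
    exact this.re_ofReal
  have hsa : ∀ θ : ℝ, AnalyticAt ℝ (fun θ : ℝ => Real.sin (θ / 2)) θ := fun θ => by fun_prop
  have hEa : ∀ θ, AnalyticAt ℝ E θ := fun θ =>
    (analyticAt_const.fun_mul (hha θ)).fun_mul ((hsa θ).fun_pow n)
  have hord0 : ∀ θ, Real.sin (θ / 2) = 0 → analyticOrderAt E θ = n := fun θ hs => by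
    have hv : Complex.exp (Complex.I * θ) - 1 = 0 := by
      rw [exp_I_mul_sub_one, hs]; simp
    have hh : h θ ≠ 0 := by
      have hz : Complex.exp (Complex.I * θ) = 1 := sub_eq_zero.1 hv
      -- The half-integral exponent leaves a sign, so the curve equals `±(n + 1)` at `z = 1`.
      have hg : Complex.exp (Complex.I * (((n + 2 : ℕ) : ℂ) / 2 * θ)) ^ 2 = 1 := by
        rw [← Complex.exp_nat_mul]
        have : ((2 : ℕ) : ℂ) * (Complex.I * (((n + 2 : ℕ) : ℂ) / 2 * θ)) =
            ((n + 2 : ℕ) : ℂ) * (Complex.I * θ) := by push_cast; ring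
        rw [this, Complex.exp_nat_mul, hz, one_pow]
      simp only [h, rootCurve, hz]
      rcases mul_self_eq_one_iff.1 ((sq _).symm.trans hg) with hg | hg <;> rw [hg] <;> simp <;>
        intro H <;> linarith [(Nat.cast_nonneg n : (0 : ℝ) ≤ n)]
    have hcos : Real.cos (θ / 2) ≠ 0 := fun hc => by
      have := Real.sin_sq_add_cos_sq (θ / 2)
      rw [hs, hc] at this
      norm_num at this
    rw [analyticOrderAt_mul_of_ne_zero (analyticAt_const.fun_mul (hha θ)) ((hsa θ).fun_pow n)
      (mul_ne_zero hC hh)]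
    change analyticOrderAt ((fun θ : ℝ => Real.sin (θ / 2)) ^ n) θ = n
    rw [analyticOrderAt_pow (hsa θ), analyticOrderAt_eq_one (hsa θ) hs (hasDerivAt_sin_half θ)
      (by simpa using hcos)]
    simp
  have hord : ∀ θ, analyticOrderAt E θ ≤ n := fun θ => by
    by_cases hs : Real.sin (θ / 2) = 0
    · exact (hord0 θ hs).le
    have e : E = fun θ => (C * Real.sin (θ / 2) ^ n) * h θ := by
      ext θ; simp only [E]; ring
    rw [e, analyticOrderAt_mul_of_ne_zero (analyticAt_const.fun_mul ((hsa θ).fun_pow n)) (hha θ)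
      (mul_ne_zero hC (pow_ne_zero n hs))]
    have hHd := hasDerivAt_rootCurve (hwd θ) (hne θ)
    have hhd : HasDerivAt h _ θ := Complex.reCLM.hasFDerivAt.comp_hasDerivAt θ hHd
    refine (analyticOrderAt_le_one (hha θ) hhd ?_).trans (by exact_mod_cast hn)
    -- At a double zero the unperturbed curve and its derivative would both have real part at most
    -- `1/2` in modulus.
    by_contra! hcon
    obtain ⟨hz0, hz1⟩ := hcon
    have hw'le : ‖w' θ‖ ≤ ((n + 2 : ℕ) : ℝ) * ρ := by
      simp only [w', norm_mul, norm_pow, Complex.norm_I, norm_exp_I_mul, hκn,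
        Complex.norm_natCast, mul_one]
      rw [hρdef, mul_pow]
      calc t ^ (n + 2) * (((n + 1 + 1 : ℕ) : ℝ) * ‖Complex.exp (Complex.I * θ) - 1‖ ^ (n + 1))
          ≤ t ^ (n + 2) * (((n + 1 + 1 : ℕ) : ℝ) * 2 ^ (n + 1)) := by
            gcongr; exact norm_exp_sub_one_le θ
        _ ≤ t ^ (n + 2) * (((n + 1 + 1 : ℕ) : ℝ) * 2 ^ (n + 2)) := by
            gcongr
            · norm_num
            · norm_num
        _ = _ := by ring
    have hgn : ‖Complex.exp (Complex.I * (((n + 2 : ℕ) : ℂ) / 2 * θ))‖ = 1 := by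
      have : Complex.I * (((n + 2 : ℕ) : ℂ) / 2 * θ) =
        Complex.I * ((((n + 2 : ℕ) : ℝ) / 2 * θ : ℝ) : ℂ) := by push_cast; ring
      rw [this, norm_exp_I_mul]
    obtain ⟨p0, p1⟩ := norm_perturbation_le hN1 hgn (norm_exp_I_mul θ) (hwle θ) hw'le hρ
    set a := ((n + 2 : ℕ) : ℝ) / 2 * θ + θ with ha
    set b := ((n + 2 : ℕ) : ℝ) / 2 * θ with hb
    have hgb : Complex.exp (Complex.I * (((n + 2 : ℕ) : ℂ) / 2 * θ)) =
        Complex.exp ((b : ℂ) * Complex.I) := by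
      rw [hb]; congr 1; push_cast; ring
    have hga : Complex.exp ((b : ℂ) * Complex.I) * Complex.exp (Complex.I * θ) =
        Complex.exp ((a : ℂ) * Complex.I) := by
      rw [ha, ← Complex.exp_add]; congr 1; push_cast; ring
    simp only [Complex.ofReal_natCast] at p0 p1
    have q0 := (Complex.abs_re_le_norm _).trans p0
    have q1 := (Complex.abs_re_le_norm _).trans p1
    have z0 : (Complex.exp (Complex.I * (((n + 2 : ℕ) : ℂ) / 2 * θ)) *
      (((n + 2 : ℕ) : ℂ) * Complex.exp (Complex.I * θ) - 1 +
        κ * (Complex.exp (Complex.I * θ) - 1) ^ (n + 2)) /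
      (1 - κ * (Complex.exp (Complex.I * θ) - 1) ^ (n + 2)) ^ 2).re = 0 := hz0
    rw [Complex.sub_re, z0, zero_sub, abs_neg] at q0
    have z1 : (Complex.I * (((n + 2 : ℕ) : ℂ) / 2) *
      (Complex.exp (Complex.I * (((n + 2 : ℕ) : ℂ) / 2 * θ)) *
      (((n + 2 : ℕ) : ℂ) * Complex.exp (Complex.I * θ) - 1 +
        κ * (Complex.exp (Complex.I * θ) - 1) ^ (n + 2)) /
      (1 - κ * (Complex.exp (Complex.I * θ) - 1) ^ (n + 2)) ^ 2) +
      Complex.exp (Complex.I * (((n + 2 : ℕ) : ℂ) / 2 * θ)) *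
        ((((n + 2 : ℕ) : ℂ) * (Complex.I * Complex.exp (Complex.I * θ)) + w' θ) /
          (1 - κ * (Complex.exp (Complex.I * θ) - 1) ^ (n + 2)) ^ 2 +
        2 * (((n + 2 : ℕ) : ℂ) * Complex.exp (Complex.I * θ) - 1 +
          κ * (Complex.exp (Complex.I * θ) - 1) ^ (n + 2)) * w' θ /
          (1 - κ * (Complex.exp (Complex.I * θ) - 1) ^ (n + 2)) ^ 3)).re = 0 := hz1
    rw [Complex.sub_re, z1, zero_sub, abs_neg] at q1
    have e0 : Complex.exp (Complex.I * (((n + 2 : ℕ) : ℂ) / 2 * θ)) *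
        (((n + 2 : ℕ) : ℂ) * Complex.exp (Complex.I * θ) - 1) =
        (((n + 2 : ℕ) : ℝ) : ℂ) * Complex.exp ((a : ℂ) * Complex.I) -
          Complex.exp ((b : ℂ) * Complex.I) := by
      rw [hgb, ← hga]; push_cast; ring
    have e1 : Complex.I * (((n + 2 : ℕ) : ℂ) / 2) *
        (Complex.exp (Complex.I * (((n + 2 : ℕ) : ℂ) / 2 * θ)) *
        (((n + 2 : ℕ) : ℂ) * Complex.exp (Complex.I * θ) - 1)) +
        Complex.exp (Complex.I * (((n + 2 : ℕ) : ℂ) / 2 * θ)) *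
        (((n + 2 : ℕ) : ℂ) * (Complex.I * Complex.exp (Complex.I * θ))) =
        ((((n + 2 : ℕ) : ℝ) / 2 : ℝ) : ℂ) * (Complex.I *
          ((((n + 2 : ℕ) : ℝ) + 2 : ℝ) * Complex.exp ((a : ℂ) * Complex.I) -
          Complex.exp ((b : ℂ) * Complex.I))) := by
      rw [hgb, ← hga]; push_cast; ring
    rw [e0, Complex.sub_re, Complex.re_ofReal_mul, Complex.exp_ofReal_mul_I_re,
      Complex.exp_ofReal_mul_I_re] at q0
    rw [e1, Complex.re_ofReal_mul, Complex.I_mul_re, Complex.sub_im, Complex.im_ofReal_mul,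
      Complex.exp_ofReal_mul_I_im, Complex.exp_ofReal_mul_I_im, mul_neg, abs_neg] at q1
    exact rootCurve_zeros_simple hN1 q0 q1
  have e2 := iteratedDeriv_two_eq hD hE
  refine ⟨powersDecay_of_analyticOrderAt hσ harg hD hE hEa (by omega) hord
    ⟨0, hord0 0 (by simp)⟩, _, harg, contDiff_of_analytic_second_deriv hD hE hEa, ?_, fun θ => ?_⟩
  · rw [e2, vanishesToOrder_iff (hEa 0)]
    exact hord0 0 (by simp)
  · rw [e2]
    exact exists_vanishesToOrder_of_le (hEa θ) (hord θ)

/-- With `α_j = ζ u^j` one has `1 - conj λ_j z = (1 - α_j (z-1)) / (1 + α_j)`. Both products over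
the roots of unity collapse, for `y = ζ(z-1)` and `y = -ζ`. -/
theorem exists_rootZeros (N : ℕ) (hN : 3 ≤ N) : ∃ t : ℝ, 0 < t ∧ t < 1 / (2 * Real.pi) ∧
      IsZeroTuple (rootZeros N t) ∧
      PowersDecay (blaschke (rootZeros N t)) N ∧
      ∃ ψ : ℝ → ℝ, IsContinuousArg (blaschke (rootZeros N t)) ψ ∧ ContDiff ℝ ∞ ψ ∧
        VanishesToOrder (iteratedDeriv 2 ψ) 0 (N - 2) ∧
        ∀ θ : ℝ, ∃ k : ℕ, k ≤ N - 2 ∧ VanishesToOrder (iteratedDeriv 2 ψ) θ k := by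
  obtain ⟨n, rfl⟩ : ∃ n, N = n + 2 := ⟨N - 2, by omega⟩
  rw [show n + 2 - 2 = n by omega]
  have hN1 : (3 : ℝ) ≤ ((n + 2 : ℕ) : ℝ) := by exact_mod_cast hN
  -- Makes `100 N² (2t) = 1`, the smallness needed for the perturbation estimate.
  set t : ℝ := 1 / (200 * ((n + 2 : ℕ) : ℝ) ^ 2) with htdef
  have ht : 0 < t := by positivity
  have htN : 100 * ((n + 2 : ℕ) : ℝ) ^ 2 * (2 * t) ≤ 1 := by
    rw [htdef]; apply le_of_eq; field_simp; norm_num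
  have htpi : t < 1 / (2 * Real.pi) := by
    rw [htdef]
    apply one_div_lt_one_div_of_lt (by positivity)
    nlinarith [Real.pi_lt_four]
  have ht2 : t < 1 / 2 := by
    refine htpi.trans ?_
    apply one_div_lt_one_div_of_lt (by norm_num)
    linarith [Real.pi_gt_three]
  set u : ℂ := Complex.exp (2 * Real.pi * Complex.I / ((n + 2 : ℕ) : ℂ)) with hu
  set ζ : ℂ := t * Complex.exp (Real.pi * Complex.I * (((n + 2 : ℕ) : ℂ) - 1) /
    (2 * ((n + 2 : ℕ) : ℂ))) with hζ
  have hprim : IsPrimitiveRoot u (n + 2) := Complex.isPrimitiveRoot_exp (n + 2) (by omega)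
  have hζN : ζ ^ (n + 2) = t ^ (n + 2) * Complex.I ^ (n + 1) := by
    rw [hζ, mul_pow, ← Complex.exp_nat_mul]
    congr 1
    have : ((n + 2 : ℕ) : ℂ) * (Real.pi * Complex.I * (((n + 2 : ℕ) : ℂ) - 1) /
        (2 * ((n + 2 : ℕ) : ℂ))) = ((n + 1 : ℕ) : ℂ) * (Real.pi / 2 * Complex.I) := by
      have : ((n + 2 : ℕ) : ℂ) ≠ 0 := Nat.cast_ne_zero.2 (by omega)
      field_simp
      push_cast
      ring
    rw [this, Complex.exp_nat_mul, Complex.exp_pi_div_two_mul_I]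
  set α : Fin (n + 2) → ℂ := fun j => ζ * u ^ ((j : ℕ) + 1)
  have hζt : ‖ζ‖ = t := by
    have : Real.pi * Complex.I * (((n + 2 : ℕ) : ℂ) - 1) / (2 * ((n + 2 : ℕ) : ℂ)) =
        Complex.I * ((Real.pi * (((n + 2 : ℕ) : ℝ) - 1) / (2 * ((n + 2 : ℕ) : ℝ)) : ℝ) : ℂ) := by
      push_cast; ring
    rw [hζ, this, norm_mul, norm_exp_I_mul, mul_one, Complex.norm_real, Real.norm_of_nonneg ht.le]
  have hαt : ∀ j, ‖α j‖ = t := fun j => by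
    rw [norm_mul, norm_pow, hprim.norm'_eq_one (by omega), one_pow, mul_one, hζt]
  have hα1 : ∀ j, t < ‖1 + α j‖ := fun j => by
    have := norm_sub_norm_le (1 : ℂ) (-α j)
    rw [norm_neg, hαt, norm_one, sub_neg_eq_add] at this
    linarith
  have hα1ne : ∀ j, 1 + α j ≠ 0 := fun j => norm_pos_iff.1 (ht.trans (hα1 j))
  have hroot : ∀ j, rootZeros (n + 2) t j = conj (α j / (1 + α j)) := fun j => by
    rw [map_div₀, map_add, map_one]
    rfl
  have hz : IsZeroTuple (rootZeros (n + 2) t) := fun j => by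
    rw [hroot]
    refine ⟨?_, ?_⟩
    · rw [RCLike.norm_conj, norm_div, hαt, div_lt_one (ht.trans (hα1 j))]
      exact hα1 j
    · rw [Ne, map_eq_zero]
      exact div_ne_zero (norm_pos_iff.1 (by rw [hαt]; exact ht)) (hα1ne j)
  refine ⟨t, ht, htpi, hz, exists_arg_rootZeros_aux (by omega) (fun j => (hz j).1) ht htN
    fun θ => ?_⟩
  have h1 := hprim.prod_one_sub_mul_pow_succ (by omega) (ζ * (Complex.exp (Complex.I * θ) - 1))
  have h2 := hprim.prod_one_sub_mul_pow_succ (by omega) (ζ * (-1))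
  rw [mul_pow, hζN] at h1 h2
  rw [← h1, ← h2, ← Finset.prod_div_distrib]
  refine Finset.prod_congr rfl fun j _ => ?_
  rw [hroot, Complex.conj_conj]
  have e : 1 - ζ * (-1) * u ^ ((j : ℕ) + 1) = 1 + α j := by simp only [α]; ring
  rw [e, eq_div_iff (hα1ne j), sub_mul, mul_right_comm, div_mul_cancel₀ _ (hα1ne j)]
  simp only [α]
  ring

/-! ### Assembly and the numerical examples -/

theorem theorem2 :
    -- every `N ≥ 3` is attained by a product of degree `N` with zeros built from roots of unity
    (∀ N : ℕ, 3 ≤ N → ∃ t : ℝ, 0 < t ∧ t < 1 / (2 * Real.pi) ∧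
      IsZeroTuple (rootZeros N t) ∧
      PowersDecay (blaschke (rootZeros N t)) N ∧
      ∃ ψ : ℝ → ℝ, IsContinuousArg (blaschke (rootZeros N t)) ψ ∧ ContDiff ℝ ∞ ψ ∧
        VanishesToOrder (iteratedDeriv 2 ψ) 0 (N - 2) ∧
        ∀ θ : ℝ, ∃ k : ℕ, k ≤ N - 2 ∧ VanishesToOrder (iteratedDeriv 2 ψ) θ k) ∧
    -- degree 1, `N = 3`
    (∀ a : ℂ, ‖a‖ < 1 → blaschke (fun _ : Fin 1 => a) ≠ id →
      PowersDecay (blaschke (fun _ : Fin 1 => a)) 3) ∧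
    -- degree 2, `N = 5`, zeros of equal modulus
    (∀ w : ℂ, w ≠ 1 → 0 < w.re →
      w.re = (w ^ 3).re → (w ^ 3).re ≠ (w ^ 5).re →
      (w ^ (-1 : ℤ)).re ≠ (w ^ (-3 : ℤ)).re →
      IsZeroTuple (cayleyZeros ![w, conj w]) ∧
      PowersDecay (blaschke (cayleyZeros ![w, conj w])) 5) ∧
    (IsZeroTuple (cayleyZeros ![2 + Complex.I, conj (2 + Complex.I)]) ∧
      PowersDecay (blaschke (cayleyZeros ![2 + Complex.I, conj (2 + Complex.I)])) 5) ∧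
    -- degree 2, `N = 5`, zeros on a diameter
    (∀ w₁ w₂ : ℝ, 0 < w₁ → w₁ ≠ 1 → 0 < w₂ → w₂ ≠ 1 →
      w₁ + w₂ = w₁ ^ 3 + w₂ ^ 3 → w₁ ^ 3 + w₂ ^ 3 ≠ w₁ ^ 5 + w₂ ^ 5 →
      w₁ ^ (-1 : ℤ) + w₂ ^ (-1 : ℤ) ≠ w₁ ^ (-3 : ℤ) + w₂ ^ (-3 : ℤ) →
      IsZeroTuple (cayleyZeros ![(w₁ : ℂ), (w₂ : ℂ)]) ∧
      PowersDecay (blaschke (cayleyZeros ![(w₁ : ℂ), (w₂ : ℂ)])) 5) ∧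
    (IsZeroTuple (cayleyZeros ![(1 / 2 : ℂ), (1 + (Real.sqrt 13 : ℂ)) / 4]) ∧
      PowersDecay (blaschke (cayleyZeros ![(1 / 2 : ℂ), (1 + (Real.sqrt 13 : ℂ)) / 4])) 5) ∧
    -- degree 4, `N = 7`
    (∀ w₁ w₂ : ℂ, w₁ ≠ 1 → w₂ ≠ 1 → 0 < w₁.re → 0 < w₂.re →
      (w₁ + w₂).re = (w₁ ^ 3 + w₂ ^ 3).re →
      (w₁ ^ 3 + w₂ ^ 3).re = (w₁ ^ 5 + w₂ ^ 5).re →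
      (w₁ ^ 5 + w₂ ^ 5).re ≠ (w₁ ^ 7 + w₂ ^ 7).re →
      (w₁ ^ (-1 : ℤ) + w₂ ^ (-1 : ℤ)).re ≠ (w₁ ^ (-3 : ℤ) + w₂ ^ (-3 : ℤ)).re →
      IsZeroTuple (cayleyZeros ![w₁, w₂, conj w₁, conj w₂]) ∧
      PowersDecay (blaschke (cayleyZeros ![w₁, w₂, conj w₁, conj w₂])) 7) ∧
    (∀ w₁ w₂ : ℂ, w₁ = 1 + 2 * Complex.I / (Real.sqrt 3 : ℂ) →
      w₂ = 2 + Complex.I / (Real.sqrt 3 : ℂ) →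
      IsZeroTuple (cayleyZeros ![w₁, w₂, conj w₁, conj w₂]) ∧
      PowersDecay (blaschke (cayleyZeros ![w₁, w₂, conj w₁, conj w₂])) 7) := by
  refine ⟨exists_rootZeros, fun a ha hid => powersDecay_degree_one ha fun h0 => hid ?_,
    fun w h1 hw h3 _ _ => powersDecay_conj_pair h1 hw h3, ?_,
    fun w₁ w₂ hw₁ h₁ hw₂ h₂ h3 _ _ => powersDecay_real_pair hw₁ h₁ hw₂ h₂ h3, ?_,
    fun w₁ w₂ h₁ h₂ hw₁ hw₂ h3 h5 h7 hinv =>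
      powersDecay_two_conj_pairs h₁ h₂ hw₁ hw₂ h3 h5 h7 hinv, ?_⟩
  · ext z
    simp [blaschke, h0]
  · refine powersDecay_conj_pair (fun h => ?_) (by simp) ?_
    · simpa using congrArg Complex.im h
    · rw [re_pow_three]; simp; norm_num
  · have hs : Real.sqrt 13 ^ 2 = 13 := Real.sq_sqrt (by norm_num)
    -- For `w₁ = 1/2` the equation is `8w³ - 8w - 3 = (2w+1)(4w²-2w-3) = 0`, whose positive root is
    -- this `w₂`.
    have h := powersDecay_real_pair (w₁ := 1 / 2) (w₂ := (1 + Real.sqrt 13) / 4) (by norm_num)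
      (by norm_num) (by positivity) (fun h => by nlinarith) (by
        linear_combination (-(3 + Real.sqrt 13) / 64) * hs)
    push_cast at h
    exact h
  · rintro w₁ w₂ hw₁ hw₂
    have hs : (Real.sqrt 3)⁻¹ ^ 2 = 1 / 3 := by
      rw [inv_pow, Real.sq_sqrt (by norm_num)]; norm_num
    have r₁ : w₁.re = 1 := by simp [hw₁, div_eq_mul_inv, ← Complex.ofReal_inv]
    have i₁ : w₁.im = 2 * (Real.sqrt 3)⁻¹ := by simp [hw₁, div_eq_mul_inv, ← Complex.ofReal_inv]
    have r₂ : w₂.re = 2 := by simp [hw₂, div_eq_mul_inv, ← Complex.ofReal_inv]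
    have i₂ : w₂.im = (Real.sqrt 3)⁻¹ := by simp [hw₂, div_eq_mul_inv, ← Complex.ofReal_inv]
    -- Real parts of odd powers involve the imaginary part only through its square, so `√3`
    -- disappears and the conditions become rational.
    have q₁ : w₁.im ^ 2 = 4 / 3 := by rw [i₁, mul_pow, hs]; norm_num
    have q₂ : w₂.im ^ 2 = 1 / 3 := by rw [i₂, hs]
    have hfour : ∀ x : ℝ, x ^ 4 = (x ^ 2) ^ 2 := fun x => by ring
    have hsix : ∀ x : ℝ, x ^ 6 = (x ^ 2) ^ 3 := fun x => by ring
    refine powersDecay_two_conj_pairs (fun h => ?_) (fun h => ?_) (by rw [r₁]; norm_num)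
      (by rw [r₂]; norm_num) ?_ ?_ ?_ ?_
    · rw [h] at q₁; norm_num at q₁
    · rw [h] at r₂; norm_num at r₂
    all_goals
      simp only [Complex.add_re, re_pow_three, re_pow_five, re_pow_seven, re_zpow_neg_one,
        re_zpow_neg_three, hfour w₁.im, hfour w₂.im, hsix, q₁, q₂, r₁, r₂]
      norm_num
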